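/- A bipartite pure state is a unit vector $|\psi\rangle\in\mathbb{C}^{A}\otimes\mathbb{C}^{B}$ (finite dimensional). Its ordered Schmidt vector is $(\lambda_1\ge\dots\ge\lambda_n\ge 0)$, $\sum_i\lambda_i=1$, if $|\psi\rangle=\sum_i\sqrt{\lambda_i}\,|u_i\rangle|v_i\rangle$ with $(u_i)$ and $(v_i)$ orthonormal. Write $|\psi\rangle\to|\varphi\rangle$ if some LOCC operation (a protocol with finitely many rounds of local measurements with finitely many outcomes and classical communication) maps $|\psi\rangle\langle\psi|$ to $|\varphi\rangle\langle\varphi|$. In tensor products of bipartite states, each party holds all of its factors. Let $(\vec\alpha,\vec\beta,N)$ be any of the following seven rows: 1. $\vec\alpha=(0.900,0.081,0.010,0.009)$, $\vec\beta=(0.950,0.030,0.020)$, $N=1$; 2. $\vec\alpha=(0.900,0.088,0.006,0.006)$, $\vec\beta=(0.950,0.030,0.020)$, $N=2$; 3. $\vec\alpha=(0.908,0.080,0.006,0.006)$, $\vec\beta=(0.950,0.030,0.020)$, $N=3$; 4. $\vec\alpha=(0.918,0.070,0.006,0.006)$, $\vec\beta=(0.950,0.030,0.020)$, $N=4$; 5.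 $\vec\alpha=(0.925,0.063,0.006,0.006)$, $\vec\beta=(0.950,0.030,0.020)$, $N=5$; 6. $\vec\alpha=(0.928,0.060,0.006,0.006)$, $\vec\beta=(0.950,0.030,0.020)$, $N=6$; 7. $\vec\alpha=(0.900,0.081,0.010,0.009)$, $\vec\beta=(0.950,0.030,0.019,0.001)$, $N=1$. Then for all bipartite pure states $|\alpha\rangle$, $|\beta\rangle$ with ordered Schmidt vectors $\vec\alpha$, $\vec\beta$: the states are incomparable, that is, neither $|\alpha\rangle\to|\beta\rangle$ nor $|\beta\rangle\to|\alpha\rangle$; and $N$ is the least integer $k\ge 0$ such that $|\alpha\rangle\otimes|\alpha\rangle^{\otimes k}\to|\beta\rangle\otimes|\alpha\rangle^{\otimes k}$. In particular, in rows 1 and 7, $|\alpha\rangle\otimes|\alpha\rangle\to|\beta\rangle\otimes|\alpha\rangle$. -/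

import Mathlib

open scoped Kronecker

/-- `IsLOCC C D A B Λ`: the map `Λ`, from operators on `ℂ^A ⊗ ℂ^B` to operators on `ℂ^C ⊗ ℂ^D`,
is implemented by a finite LOCC protocol between two parties holding the tensor factors.

A protocol either stops, or one party performs a local measurement with finitely many outcomes
`k : K` and Kraus operators `E k` (`∑ k, (E k)ᴴ * E k = 1`; the local output space may depend on
`k`), announces the outcome, and the parties go on with an LOCC protocol that may depend on the
outcome.  The record of outcomes is forgotten at the end (sum over `k`).  Unitaries,
ancillas, partial traces, local channels and shared randomness are special cases. -/
inductive IsLOCC (C D : Type) [Fintype C] [DecidableEq C] [Fintype D] [DecidableEq D] :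
    (A B : Type) → [Fintype A] → [DecidableEq A] → [Fintype B] → [DecidableEq B] →
    (Matrix (A × B) (A × B) ℂ → Matrix (C × D) (C × D) ℂ) → Prop
  | finish : IsLOCC C D C D (fun ρ => ρ)
  | first {A B K : Type} [Fintype A] [DecidableEq A] [Fintype B] [DecidableEq B] [Fintype K]
      (A' : K → Type) [∀ k, Fintype (A' k)] [∀ k, DecidableEq (A' k)]
      (E : ∀ k, Matrix (A' k) A ℂ) (hE : ∑ k, (E k).conjTranspose * E k = 1)
      (Λ : ∀ k, Matrix (A' k × B) (A' k × B) ℂ → Matrix (C × D) (C × D) ℂ)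
      (hΛ : ∀ k, IsLOCC C D (A' k) B (Λ k)) :
      IsLOCC C D A B (fun ρ => ∑ k, Λ k
        ((E k ⊗ₖ (1 : Matrix B B ℂ)) * ρ * (E k ⊗ₖ (1 : Matrix B B ℂ)).conjTranspose))
  | second {A B K : Type} [Fintype A] [DecidableEq A] [Fintype B] [DecidableEq B] [Fintype K]
      (B' : K → Type) [∀ k, Fintype (B' k)] [∀ k, DecidableEq (B' k)]
      (E : ∀ k, Matrix (B' k) B ℂ) (hE : ∑ k, (E k).conjTranspose * E k = 1)
      (Λ : ∀ k, Matrix (A × B' k) (A × B' k) ℂ → Matrix (C × D) (C × D) ℂ)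
      (hΛ : ∀ k, IsLOCC C D A (B' k) (Λ k)) :
      IsLOCC C D A B (fun ρ => ∑ k, Λ k
        (((1 : Matrix A A ℂ) ⊗ₖ E k) * ρ * ((1 : Matrix A A ℂ) ⊗ₖ E k).conjTranspose))

/-- The operator `|ψ⟩⟨ψ|`. -/
def ketbra {X : Type} (ψ : X → ℂ) : Matrix X X ℂ :=
  Matrix.vecMulVec ψ (star ψ)

/-- `|ψ⟩ → |φ⟩`: some LOCC operation takes `|ψ⟩⟨ψ|` to `|φ⟩⟨φ|`. A vector of `ℂ^A ⊗ ℂ^B` is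
given by its coordinates `A × B → ℂ`. -/
def Accesses {A B C D : Type} [Fintype A] [DecidableEq A] [Fintype B] [DecidableEq B]
    [Fintype C] [DecidableEq C] [Fintype D] [DecidableEq D]
    (ψ : A × B → ℂ) (φ : C × D → ℂ) : Prop :=
  ∃ Λ, IsLOCC C D A B Λ ∧ Λ (ketbra ψ) = ketbra φ

/-- Tensor product of bipartite vectors, as a bipartite vector: the first party holds both first
factors, the second party both second factors. -/
def tensorState {A B C D : Type} (ψ : A × B → ℂ) (φ : C × D → ℂ) :
    (A × C) × (B × D) → ℂ :=
  fun p => ψ (p.1.1, p.2.1) * φ (p.1.2, p.2.2)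

/-- `N` copies `|ψ⟩^{⊗ N}` of a bipartite vector, as a bipartite vector. -/
def copies {A B : Type} (N : ℕ) (ψ : A × B → ℂ) :
    (Fin N → A) × (Fin N → B) → ℂ :=
  fun p => ∏ i, ψ (p.1 i, p.2 i)

/-- `l` is an ordered Schmidt vector of the bipartite unit vector `ψ`:
`ψ = ∑ i, √(l i) • u i ⊗ v i` with `u` and `v` orthonormal. -/
def IsSchmidtVector {A B : Type} [Fintype A] [Fintype B] {n : ℕ}
    (ψ : A × B → ℂ) (l : Fin n → ℝ) : Prop :=
  Antitone l ∧ (∀ i, 0 ≤ l i) ∧ ∑ i, l i = 1 ∧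
    ∃ (u : Fin n → EuclideanSpace ℂ A) (v : Fin n → EuclideanSpace ℂ B),
      Orthonormal ℂ u ∧ Orthonormal ℂ v ∧
      ∀ a b, ψ (a, b) = ∑ i, (Real.sqrt (l i) : ℂ) * u i a * v i b

/-- The vector `∑ i, √(l i) |ii⟩` of `ℂ^n ⊗ ℂ^n`. -/
noncomputable def diagonalState {n : ℕ} (l : Fin n → ℝ) : Fin n × Fin n → ℂ :=
  fun p => if p.1 = p.2 then (Real.sqrt (l p.1) : ℂ) else 0

/-- Every ordered probability vector of length `n` is a Schmidt vector of a state of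
`ℂ^n ⊗ ℂ^n`. -/
theorem isSchmidtVector_diagonalState {n : ℕ} (l : Fin n → ℝ) (h : Antitone l)
    (h0 : ∀ i, 0 ≤ l i) (h1 : ∑ i, l i = 1) : IsSchmidtVector (diagonalState l) l := by
  refine ⟨h, h0, h1, fun i => EuclideanSpace.basisFun (Fin n) ℂ i,
    fun i => EuclideanSpace.basisFun (Fin n) ℂ i,
    (EuclideanSpace.basisFun (Fin n) ℂ).orthonormal,
    (EuclideanSpace.basisFun (Fin n) ℂ).orthonormal, ?_⟩
  intro a b
  by_cases hab : a = b <;> simp [diagonalState, hab]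

/-- States with Schmidt vectors `α` and `β` are incomparable under LOCC. -/
def Incomparable {n m : ℕ} (α : Fin n → ℝ) (β : Fin m → ℝ) : Prop :=
  ∀ {A B C D : Type} [Fintype A] [DecidableEq A] [Fintype B] [DecidableEq B]
    [Fintype C] [DecidableEq C] [Fintype D] [DecidableEq D]
    (ψ : A × B → ℂ) (φ : C × D → ℂ), IsSchmidtVector ψ α → IsSchmidtVector φ β →
    ¬ Accesses ψ φ ∧ ¬ Accesses φ ψ

/-- For states `ψ`, `φ` with Schmidt vectors `α`, `β`: `ψ ⊗ ψ → φ ⊗ ψ`. -/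
def SelfCatalyses {n m : ℕ} (α : Fin n → ℝ) (β : Fin m → ℝ) : Prop :=
  ∀ {A B C D : Type} [Fintype A] [DecidableEq A] [Fintype B] [DecidableEq B]
    [Fintype C] [DecidableEq C] [Fintype D] [DecidableEq D]
    (ψ : A × B → ℂ) (φ : C × D → ℂ), IsSchmidtVector ψ α → IsSchmidtVector φ β →
    Accesses (tensorState ψ ψ) (tensorState φ ψ)

/-- For states `ψ`, `φ` with Schmidt vectors `α`, `β`: `N` is the least number of copies with
`ψ ⊗ ψ^{⊗ N} → φ ⊗ ψ^{⊗ N}`. -/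
def MinimalCopies {n m : ℕ} (α : Fin n → ℝ) (β : Fin m → ℝ) (N : ℕ) : Prop :=
  ∀ {A B C D : Type} [Fintype A] [DecidableEq A] [Fintype B] [DecidableEq B]
    [Fintype C] [DecidableEq C] [Fintype D] [DecidableEq D]
    (ψ : A × B → ℂ) (φ : C × D → ℂ), IsSchmidtVector ψ α → IsSchmidtVector φ β →
    IsLeast {k : ℕ | Accesses (tensorState ψ (copies k ψ)) (tensorState φ (copies k ψ))} N

/-! The engine is Nielsen's theorem: a pure state can be converted to another by LOCC exactly when
its Schmidt vector is majorized by that of the target. Majorization is expressed here by excesses: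
for equal totals, `x` is majorized by `y` iff the sum of `max (x i - t) 0` is at most that of `max
(y i - t) 0` for every `t ≥ 0`.

Necessity (`Accesses.excess_le`) rests on low-rank approximation. Local Kraus operators multiply the
coefficient matrix from the left or the right, so they never raise the rank of an approximant, and
completeness preserves the total squared error. A good truncation of the source thus yields equally
good approximations of the branches. Each branch is a multiple of the pure target, and
`le_frobSq_sub` bounds from below how well a low-rank matrix can approximate it.

Sufficiency (`accesses_of_excess_le`) writes the source Schmidt vector as a mixture of
rearrangements of the target vector. This mixture defines one measurement by the first party, and
the second party corrects its basis according to the outcome.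

Schmidt coefficients of tensor products are products of Schmidt coefficients. The excess of the
target is piecewise affine in `t` and that of the source is convex, so it suffices to compare them
at `0` and at the target's entries. After clearing denominators this is a finite computation with
natural numbers, carried out on lists of values with multiplicities. Each failing number of copies
is refuted by a single threshold. -/

/-! ### Frobenius norm and approximation by matrices of bounded rank -/

section Frobenius

theorem conjTranspose_mul_self_apply {A B : Type} [Fintype A] (X : Matrix A B ℂ) (j : B) :
    (X.conjTranspose * X) j j = ((∑ i, ‖X i j‖ ^ 2 : ℝ) : ℂ) := by
  simp [Matrix.mul_apply, ← Complex.normSq_eq_conj_mul_self, Complex.normSq_eq_norm_sq]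

variable {A B ι K : Type} [Fintype A] [Fintype B] [Fintype ι] [Fintype K]

/-- The squared Frobenius norm. -/
noncomputable def frobSq (X : Matrix A B ℂ) : ℝ := ∑ i, ∑ j, ‖X i j‖ ^ 2

theorem frobSq_nonneg (X : Matrix A B ℂ) : 0 ≤ frobSq X := by
  unfold frobSq; positivity

theorem ofReal_frobSq (X : Matrix A B ℂ) : (frobSq X : ℂ) = (X.conjTranspose * X).trace := by
  unfold frobSq
  rw [Finset.sum_comm]
  simp only [Matrix.trace, Matrix.diag_apply, conjTranspose_mul_self_apply, Complex.ofReal_sum]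

theorem frobSq_conjTranspose (X : Matrix A B ℂ) : frobSq X.conjTranspose = frobSq X := by
  unfold frobSq
  rw [Finset.sum_comm]
  simp

theorem frobSq_transpose (X : Matrix A B ℂ) : frobSq X.transpose = frobSq X := by
  unfold frobSq
  rw [Finset.sum_comm]
  simp

theorem frobSq_smul (c : ℂ) (X : Matrix A B ℂ) : frobSq (c • X) = ‖c‖ ^ 2 * frobSq X := by
  simp [frobSq, mul_pow, Finset.mul_sum]

/-- The completeness relation of the Kraus operators, inserted under the trace, makes the squared
norm additive over outcomes. Applied to a difference, it says that a measurement preserves the total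
approximation error. -/
theorem sum_frobSq_mul [DecidableEq A] {A' : K → Type} [∀ k, Fintype (A' k)]
    (E : ∀ k, Matrix (A' k) A ℂ) (hE : ∑ k, (E k).conjTranspose * E k = 1) (X : Matrix A B ℂ) :
    ∑ k, frobSq (E k * X) = frobSq X := by
  have h : ((∑ k, frobSq (E k * X) : ℝ) : ℂ) = (frobSq X : ℂ) := by
    simp only [Complex.ofReal_sum, ofReal_frobSq]
    calc ∑ k, ((E k * X).conjTranspose * (E k * X)).trace
        = ∑ k, (X.conjTranspose * ((E k).conjTranspose * E k) * X).trace := by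
          simp only [Matrix.conjTranspose_mul, Matrix.mul_assoc]
      _ = (X.conjTranspose * (∑ k, (E k).conjTranspose * E k) * X).trace := by
          rw [← Matrix.trace_sum, Matrix.mul_sum, Matrix.sum_mul]
      _ = _ := by rw [hE, Matrix.mul_one]
  exact_mod_cast h

theorem sum_frobSq_mul_transpose [DecidableEq B] {B' : K → Type} [∀ k, Fintype (B' k)]
    (E : ∀ k, Matrix (B' k) B ℂ) (hE : ∑ k, (E k).conjTranspose * E k = 1) (X : Matrix A B ℂ) :
    ∑ k, frobSq (X * (E k).transpose) = frobSq X := by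
  rw [← frobSq_transpose X, ← sum_frobSq_mul E hE]
  refine Finset.sum_congr rfl fun k _ => ?_
  rw [← frobSq_transpose, Matrix.transpose_mul, Matrix.transpose_transpose]

theorem compl_mul_compl [DecidableEq A] [DecidableEq ι] (Q : Matrix A ι ℂ)
    (hQ : Q.conjTranspose * Q = 1) :
    (1 - Q * Q.conjTranspose).conjTranspose * (1 - Q * Q.conjTranspose)
      = 1 - Q * Q.conjTranspose := by
  have h : Q * Q.conjTranspose * (Q * Q.conjTranspose) = Q * Q.conjTranspose := by
    rw [Matrix.mul_assoc, ← Matrix.mul_assoc Q.conjTranspose, hQ, Matrix.one_mul]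
  rw [Matrix.conjTranspose_sub, Matrix.conjTranspose_mul, Matrix.conjTranspose_conjTranspose,
    Matrix.conjTranspose_one, Matrix.sub_mul, Matrix.mul_sub, Matrix.mul_sub, h]
  simp

/-- Pythagoras for the projection `Q * Qᴴ` and its complement; the isometry `Q` does not change
norms. -/
theorem frobSq_compl_mul_add [DecidableEq A] [DecidableEq ι] (Q : Matrix A ι ℂ)
    (hQ : Q.conjTranspose * Q = 1) (X : Matrix A B ℂ) :
    frobSq ((1 - Q * Q.conjTranspose) * X) + frobSq (Q.conjTranspose * X) = frobSq X := by
  have h : ((frobSq ((1 - Q * Q.conjTranspose) * X) + frobSq (Q.conjTranspose * X) : ℝ) : ℂ)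
      = (frobSq X : ℂ) := by
    rw [Complex.ofReal_add]
    simp only [ofReal_frobSq]
    rw [Matrix.conjTranspose_mul, Matrix.conjTranspose_mul, Matrix.conjTranspose_conjTranspose,
      ← Matrix.trace_add, Matrix.mul_assoc, ← Matrix.mul_assoc (Matrix.conjTranspose _) _ X,
      compl_mul_compl Q hQ]
    congr 1
    rw [Matrix.sub_mul, Matrix.mul_sub, Matrix.one_mul]
    simp only [Matrix.mul_assoc]
    abel
  exact_mod_cast h

theorem frobSq_compl_mul_le [DecidableEq A] [DecidableEq ι] (Q : Matrix A ι ℂ)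
    (hQ : Q.conjTranspose * Q = 1) (X : Matrix A B ℂ) :
    frobSq ((1 - Q * Q.conjTranspose) * X) ≤ frobSq X := by
  have := frobSq_compl_mul_add Q hQ X
  have := frobSq_nonneg (Q.conjTranspose * X)
  linarith

theorem frobSq_conjTranspose_mul_le [DecidableEq A] [DecidableEq ι] (Q : Matrix A ι ℂ)
    (hQ : Q.conjTranspose * Q = 1) (X : Matrix A B ℂ) :
    frobSq (Q.conjTranspose * X) ≤ frobSq X := by
  have := frobSq_compl_mul_add Q hQ X
  have := frobSq_nonneg ((1 - Q * Q.conjTranspose) * X)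
  linarith

theorem frobSq_mul_map_star_le [DecidableEq B] [DecidableEq ι] (V : Matrix B ι ℂ)
    (hV : V.conjTranspose * V = 1) (X : Matrix A B ℂ) :
    frobSq (X * V.map star) ≤ frobSq X := by
  rw [← frobSq_transpose, ← frobSq_transpose X, Matrix.transpose_mul]
  exact frobSq_conjTranspose_mul_le V hV X.transpose

/-- The columns of `Q` form an orthonormal basis of the column space of `ν`, so `Q * Qᴴ` is the
projection onto it. -/
theorem exists_isometry_mul_eq [DecidableEq A] (ν : Matrix A B ℂ) :
    ∃ Q : Matrix A (Fin ν.rank) ℂ, Q.conjTranspose * Q = 1 ∧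
      Q * Q.conjTranspose * ν = ν := by
  classical
  let W : Submodule ℂ (EuclideanSpace ℂ A) :=
    (LinearMap.range ν.mulVecLin).map (WithLp.linearEquiv 2 ℂ (A → ℂ)).symm.toLinearMap
  have hW : Module.finrank ℂ W = ν.rank :=
    LinearEquiv.finrank_map_eq (WithLp.linearEquiv 2 ℂ (A → ℂ)).symm _
  let e := (stdOrthonormalBasis ℂ W).reindex (finCongr hW)
  refine ⟨Matrix.of fun a i => (e i : EuclideanSpace ℂ A) a, ?_, ?_⟩
  · ext i j
    have h := orthonormal_iff_ite.1 e.orthonormal i j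
    rw [Submodule.coe_inner, EuclideanSpace.inner_eq_star_dotProduct] at h
    rw [Matrix.one_apply, ← h, Matrix.mul_apply, dotProduct]
    exact Finset.sum_congr rfl fun a _ => by simp [mul_comm]
  · ext a b
    let w : W := ⟨WithLp.toLp 2 (ν.col b), ⟨ν.col b,
      ⟨Pi.single b 1, by simp⟩, rfl⟩⟩
    have h := congrArg (fun x : W => (x : EuclideanSpace ℂ A) a) (e.sum_repr' w)
    simp only [Submodule.coe_sum, Submodule.coe_smul, Submodule.coe_inner] at h
    have hw : (w : EuclideanSpace ℂ A) a = ν a b := rfl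
    rw [hw] at h
    rw [← h, Matrix.mul_assoc, Matrix.mul_apply]
    simp only [WithLp.ofLp_sum, WithLp.ofLp_smul, Finset.sum_apply, Pi.smul_apply, smul_eq_mul]
    refine Finset.sum_congr rfl fun i _ => ?_
    rw [mul_comm, EuclideanSpace.inner_eq_star_dotProduct, Matrix.mul_apply, dotProduct]
    congr 1
    exact Finset.sum_congr rfl fun a _ => by simp [w, mul_comm]

/-- The amount by which the entries of `l` exceed the threshold `t`. -/
noncomputable def excess (l : ι → ℝ) (t : ℝ) : ℝ := ∑ i, max (l i - t) 0

/-- Lower bound in the Eckart–Young theorem. -/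
theorem le_frobSq_sub [DecidableEq A] [DecidableEq B] [DecidableEq ι] {l : ι → ℝ}
    (hl : ∀ i, 0 ≤ l i) (U : Matrix A ι ℂ) (V : Matrix B ι ℂ)
    (hU : U.conjTranspose * U = 1) (hV : V.conjTranspose * V = 1) (c : ℂ) (ν : Matrix A B ℂ)
    {t : ℝ} (ht : 0 ≤ t) :
    ‖c‖ ^ 2 * (∑ i, l i - excess l t - t * ν.rank) ≤
      frobSq (c • (U * Matrix.diagonal (fun i => (Real.sqrt (l i) : ℂ)) * V.transpose) - ν) := by
  obtain ⟨Q, hQ, hν⟩ := exists_isometry_mul_eq ν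
  -- Multiplying by `P` on the left kills `ν`, and multiplying by the conjugate of `V` on the right
  -- strips off `V.transpose`. Neither increases the norm, so it suffices to bound the norm of `P *
  -- U * D`.
  set P := 1 - Q * Q.conjTranspose with hP
  set D := Matrix.diagonal (fun i => (Real.sqrt (l i) : ℂ)) with hD
  have hVV : V.transpose * V.map star = 1 := by
    have := congrArg Matrix.transpose hV
    rw [Matrix.transpose_mul, Matrix.transpose_one] at this
    exact this
  have hPν : P * ν = 0 := by rw [hP, Matrix.sub_mul, hν, Matrix.one_mul, sub_self]
  have h1 : P * ((c • (U * D * V.transpose) - ν) * V.map star) = c • (P * U * D) := by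
    rw [← Matrix.mul_assoc, Matrix.mul_sub, hPν, sub_zero, Matrix.mul_smul, Matrix.smul_mul]
    simp only [Matrix.mul_assoc]
    rw [hVV, Matrix.mul_one]
  refine le_trans ?_ (frobSq_mul_map_star_le V hV _)
  refine le_trans ?_ (frobSq_compl_mul_le Q hQ _)
  rw [h1, frobSq_smul]
  refine mul_le_mul_of_nonneg_left ?_ (by positivity)
  -- The weight of the `i`-th column of `U` in the range of `Q`. These weights lie in `[0, 1]` and
  -- sum to at most the rank, which is all that the bound needs.
  set p : ι → ℝ := fun i => ∑ e, ‖(Q.conjTranspose * U) e i‖ ^ 2 with hp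
  have hp0 : ∀ i, 0 ≤ p i := fun i => by positivity
  have hcol : ∀ i, ∑ a, ‖(P * U) a i‖ ^ 2 = 1 - p i := by
    intro i
    have h2 : (P * U).conjTranspose * (P * U)
        = 1 - (Q.conjTranspose * U).conjTranspose * (Q.conjTranspose * U) := by
      rw [Matrix.conjTranspose_mul, Matrix.mul_assoc, ← Matrix.mul_assoc P.conjTranspose,
        compl_mul_compl Q hQ, Matrix.sub_mul, Matrix.mul_sub, Matrix.one_mul, hU,
        Matrix.conjTranspose_mul, Matrix.conjTranspose_conjTranspose]
      simp only [Matrix.mul_assoc]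
    have h3 := congrFun (congrFun h2 i) i
    rw [Matrix.sub_apply, conjTranspose_mul_self_apply, conjTranspose_mul_self_apply,
      Matrix.one_apply_eq] at h3
    exact_mod_cast h3
  have hp1 : ∀ i, p i ≤ 1 := fun i => by
    have h : 0 ≤ ∑ a, ‖(P * U) a i‖ ^ 2 := by positivity
    rw [hcol] at h
    linarith
  have hpsum : ∑ i, p i ≤ ν.rank := by
    have h2 : ∑ i, p i = frobSq (Q.conjTranspose * U) := by
      rw [hp, frobSq, Finset.sum_comm]
    have h3 : frobSq Q = ν.rank := by
      have : (frobSq Q : ℂ) = ((ν.rank : ℝ) : ℂ) := by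
        rw [ofReal_frobSq, hQ]; simp
      exact_mod_cast this
    rw [h2, ← h3, ← frobSq_conjTranspose, Matrix.conjTranspose_mul,
      Matrix.conjTranspose_conjTranspose]
    exact frobSq_conjTranspose_mul_le U hU Q
  have hfrob : frobSq (P * U * D) = ∑ i, l i * (1 - p i) := by
    rw [frobSq, Finset.sum_comm]
    refine Finset.sum_congr rfl fun i _ => ?_
    rw [← hcol, Finset.mul_sum]
    refine Finset.sum_congr rfl fun a _ => ?_
    rw [hD, Matrix.mul_diagonal, norm_mul, mul_pow, Complex.norm_real, Real.norm_eq_abs, sq_abs,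
      Real.sq_sqrt (hl i), mul_comm]
  rw [hfrob]
  -- Split `l i = (l i - t) + t` and use `p i ≤ 1` only on the positive part of the first term.
  have h4 : ∀ i, l i * p i ≤ max (l i - t) 0 + t * p i := by
    intro i
    have h5 : (l i - t) * p i ≤ max (l i - t) 0 * p i :=
      mul_le_mul_of_nonneg_right (le_max_left _ _) (hp0 i)
    have h6 : max (l i - t) 0 * p i ≤ max (l i - t) 0 :=
      mul_le_of_le_one_right (le_max_right _ _) (hp1 i)
    linarith
  have h7 := Finset.sum_le_sum fun i (_ : i ∈ Finset.univ) => h4 i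
  rw [Finset.sum_add_distrib, ← Finset.mul_sum] at h7
  have h8 := mul_le_mul_of_nonneg_left hpsum ht
  simp only [mul_sub, mul_one, Finset.sum_sub_distrib]
  unfold excess
  linarith

/-- Truncating a Schmidt decomposition to the indices in `S`. -/
theorem exists_rank_le_frobSq_sub_eq [DecidableEq ι] {l : ι → ℝ}
    (hl : ∀ i, 0 ≤ l i) (U : Matrix A ι ℂ) (V : Matrix B ι ℂ)
    (hU : U.conjTranspose * U = 1) (hV : V.conjTranspose * V = 1) (S : Finset ι) :
    ∃ ν : Matrix A B ℂ, ν.rank ≤ S.card ∧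
      frobSq (U * Matrix.diagonal (fun i => (Real.sqrt (l i) : ℂ)) * V.transpose - ν)
        = ∑ i, l i - ∑ i ∈ S, l i := by
  let d : ι → ℂ := fun i => if i ∈ S then (Real.sqrt (l i) : ℂ) else 0
  refine ⟨U * Matrix.diagonal d * V.transpose, ?_, ?_⟩
  · refine (Matrix.rank_mul_le_left _ _).trans ((Matrix.rank_mul_le_right _ _).trans ?_)
    rw [Matrix.rank_diagonal, Fintype.card_subtype]
    refine Finset.card_le_card fun i hi => ?_
    by_contra h
    simp [d, h] at hi
  · rw [← Matrix.sub_mul, ← Matrix.mul_sub, Matrix.diagonal_sub]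
    set f : ι → ℂ := fun i => (Real.sqrt (l i) : ℂ) - d i with hf
    have hVV : V.transpose * V.map star = 1 := by
      have := congrArg Matrix.transpose hV
      rw [Matrix.transpose_mul, Matrix.transpose_one] at this
      exact this
    have h1 : (frobSq (U * Matrix.diagonal f * V.transpose) : ℂ)
        = ((frobSq (Matrix.diagonal f) : ℝ) : ℂ) := by
      rw [ofReal_frobSq, ofReal_frobSq]
      have h2 : (U * Matrix.diagonal f * V.transpose).conjTranspose
          = V.map star * (Matrix.diagonal f).conjTranspose * U.conjTranspose := by
        rw [Matrix.conjTranspose_mul, Matrix.conjTranspose_mul, Matrix.mul_assoc]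
        rfl
      rw [h2]
      have h3 : V.map star * (Matrix.diagonal f).conjTranspose * U.conjTranspose *
          (U * Matrix.diagonal f * V.transpose)
          = V.map star * ((Matrix.diagonal f).conjTranspose * ((U.conjTranspose * U) *
            Matrix.diagonal f * V.transpose)) := by
        simp only [Matrix.mul_assoc]
      rw [h3, Matrix.trace_mul_comm, hU, Matrix.one_mul]
      simp only [Matrix.mul_assoc]
      rw [hVV, Matrix.mul_one]
    rw [Complex.ofReal_inj.1 h1, frobSq]
    have h4 : ∀ i, ∑ j, ‖Matrix.diagonal f i j‖ ^ 2 = l i - if i ∈ S then l i else 0 := by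
      intro i
      rw [Finset.sum_eq_single i]
      · by_cases h : i ∈ S
        · simp [hf, d, h]
        · simp [hf, d, h, Real.sq_sqrt (hl i)]
      · intro j _ hj
        simp [Matrix.diagonal_apply_ne' _ hj]
      · simp
    simp [h4]

end Frobenius

/-! ### Necessity of majorization for LOCC conversion -/

section Necessity

/-- The vector of `ℂ^A ⊗ ℂ^B` with coefficient matrix `M`. -/
def bipartiteVec {A B : Type} (M : Matrix A B ℂ) : A × B → ℂ := fun p => M p.1 p.2

theorem mul_ketbra_mul {X Y : Type} [Fintype X] (E : Matrix Y X ℂ) (ψ : X → ℂ) :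
    E * ketbra ψ * E.conjTranspose = ketbra (E.mulVec ψ) := by
  rw [ketbra, Matrix.mul_vecMulVec, Matrix.vecMulVec_mul, ketbra, Matrix.star_mulVec]

theorem kronecker_one_mulVec {A A' B : Type} [Fintype A] [Fintype B] [DecidableEq B]
    (E : Matrix A' A ℂ) (M : Matrix A B ℂ) :
    (E ⊗ₖ (1 : Matrix B B ℂ)).mulVec (bipartiteVec M) = bipartiteVec (E * M) := by
  ext p
  simp [Matrix.mulVec, dotProduct, Fintype.sum_prod_type, bipartiteVec, Matrix.mul_apply,
    Matrix.one_apply]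

theorem one_kronecker_mulVec {A B B' : Type} [Fintype A] [Fintype B] [DecidableEq A]
    (E : Matrix B' B ℂ) (M : Matrix A B ℂ) :
    ((1 : Matrix A A ℂ) ⊗ₖ E).mulVec (bipartiteVec M) = bipartiteVec (M * E.transpose) := by
  ext p
  simp [Matrix.mulVec, dotProduct, Fintype.sum_prod_type_right, bipartiteVec, Matrix.mul_apply,
    Matrix.one_apply, mul_comm]

/-- An LOCC operation takes a pure state to an ensemble of pure states, and an approximation of
the former of rank at most `r` to such approximations of the latter, with the same total error. -/
theorem IsLOCC.exists_ensemble {C D : Type} [Fintype C] [DecidableEq C] [Fintype D]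
    [DecidableEq D] {A B : Type} [Fintype A] [DecidableEq A] [Fintype B] [DecidableEq B]
    {Λ : Matrix (A × B) (A × B) ℂ → Matrix (C × D) (C × D) ℂ} (h : IsLOCC C D A B Λ) :
    ∀ M ν : Matrix A B ℂ, ∃ (J : Type) (_ : Fintype J) (χ μ : J → Matrix C D ℂ),
      Λ (ketbra (bipartiteVec M)) = ∑ j, ketbra (bipartiteVec (χ j)) ∧
      (∀ j, (μ j).rank ≤ ν.rank) ∧ ∑ j, frobSq (χ j - μ j) = frobSq (M - ν) := by
  induction h with
  | finish =>
    intro M ν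
    exact ⟨Unit, inferInstance, fun _ => M, fun _ => ν, by simp, by simp, by simp⟩
  | first A' E hE Λ hΛ ih =>
    intro M ν
    choose J hJ χ μ h1 h2 h3 using fun k => ih k (E k * M) (E k * ν)
    refine ⟨Σ k, J k, inferInstance, fun j => χ j.1 j.2, fun j => μ j.1 j.2, ?_, ?_, ?_⟩
    · simp only [mul_ketbra_mul, kronecker_one_mulVec, h1, Fintype.sum_sigma]
    · exact fun j => (h2 j.1 j.2).trans (Matrix.rank_mul_le_right _ _)
    · simp only [Fintype.sum_sigma, h3, ← Matrix.mul_sub]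
      exact sum_frobSq_mul E hE _
  | second B' E hE Λ hΛ ih =>
    intro M ν
    choose J hJ χ μ h1 h2 h3 using fun k => ih k (M * (E k).transpose) (ν * (E k).transpose)
    refine ⟨Σ k, J k, inferInstance, fun j => χ j.1 j.2, fun j => μ j.1 j.2, ?_, ?_, ?_⟩
    · simp only [mul_ketbra_mul, one_kronecker_mulVec, h1, Fintype.sum_sigma]
    · exact fun j => (h2 j.1 j.2).trans (Matrix.rank_mul_le_left _ _)
    · simp only [Fintype.sum_sigma, h3, ← Matrix.sub_mul]
      exact sum_frobSq_mul_transpose E hE _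

/-- The members of an ensemble realizing a pure state are multiples of it. -/
theorem exists_smul_of_sum_ketbra_eq {X J : Type} [Fintype X] [Fintype J] {χ : J → X → ℂ}
    {φ : X → ℂ} (hφ : star φ ⬝ᵥ φ = 1) (h : ∑ j, ketbra (χ j) = ketbra φ) :
    ∃ c : J → ℂ, (∀ j, χ j = c j • φ) ∧ ∑ j, ‖c j‖ ^ 2 = 1 := by
  -- The quadratic forms of both operators agree at every `w`. Below, `w` is the component of `χ j`
  -- orthogonal to `φ`, which forces that component to vanish.
  have key : ∀ w : X → ℂ, ∑ j, ‖star w ⬝ᵥ χ j‖ ^ 2 = ‖star w ⬝ᵥ φ‖ ^ 2 := by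
    intro w
    have hk : ∀ η : X → ℂ, star w ⬝ᵥ (ketbra η).mulVec w = ((‖star w ⬝ᵥ η‖ ^ 2 : ℝ) : ℂ) := by
      intro η
      rw [ketbra, Matrix.vecMulVec_mulVec, ← Complex.normSq_eq_norm_sq, Complex.normSq_eq_conj_mul_self,
        dotProduct_smul, Matrix.star_dotProduct η w]
      simp [mul_comm]
    have h1 := congrArg (fun R : Matrix X X ℂ => star w ⬝ᵥ R.mulVec w) h
    simp only [Matrix.sum_mulVec, dotProduct_sum, hk] at h1
    exact_mod_cast h1
  refine ⟨fun j => star φ ⬝ᵥ χ j, fun j => ?_, ?_⟩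
  · set c := star φ ⬝ᵥ χ j with hc
    have h0 : star (χ j - c • φ) ⬝ᵥ φ = 0 := by
      rw [star_sub, sub_dotProduct, star_smul, smul_dotProduct, hφ, hc, ← Matrix.star_dotProduct]
      simp
    have h1 := key (χ j - c • φ)
    rw [h0, norm_zero, zero_pow two_ne_zero,
      Finset.sum_eq_zero_iff_of_nonneg (fun _ _ => by positivity)] at h1
    have h2 := pow_eq_zero_iff two_ne_zero |>.1 (h1 j (Finset.mem_univ _))
    rw [norm_eq_zero] at h2
    have h3 : star (χ j - c • φ) ⬝ᵥ (χ j - c • φ) = 0 := by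
      rw [dotProduct_sub, h2, dotProduct_smul, h0, smul_zero, sub_zero]
    open scoped ComplexOrder in
    exact sub_eq_zero.1 (dotProduct_star_self_eq_zero.1 h3)
  · rw [key, hφ]; simp

/-- `l` is the family of (not necessarily ordered or normalized) Schmidt coefficients of `ψ`. -/
def HasSchmidt {A B ι : Type} [Fintype A] [Fintype B] [Fintype ι] [DecidableEq ι]
    (ψ : A × B → ℂ) (l : ι → ℝ) : Prop :=
  (∀ i, 0 ≤ l i) ∧ ∃ (U : Matrix A ι ℂ) (V : Matrix B ι ℂ),
    U.conjTranspose * U = 1 ∧ V.conjTranspose * V = 1 ∧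
    ψ = bipartiteVec (U * Matrix.diagonal (fun i => (Real.sqrt (l i) : ℂ)) * V.transpose)

theorem star_dotProduct_bipartiteVec {A B : Type} [Fintype A] [Fintype B] (M : Matrix A B ℂ) :
    star (bipartiteVec M) ⬝ᵥ bipartiteVec M = (frobSq M : ℂ) := by
  simp [dotProduct, bipartiteVec, frobSq, Fintype.sum_prod_type,
    ← Complex.normSq_eq_conj_mul_self, Complex.normSq_eq_norm_sq]

/-- The error of the best truncation of the source is compared with the Eckart–Young bound on every
branch; the squared branch amplitudes sum to one. -/
theorem Accesses.excess_le {A B C D ι κ : Type} [Fintype A] [DecidableEq A] [Fintype B]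
    [DecidableEq B] [Fintype C] [DecidableEq C] [Fintype D] [DecidableEq D] [Fintype ι]
    [DecidableEq ι] [Fintype κ] [DecidableEq κ] {ψ : A × B → ℂ} {φ : C × D → ℂ}
    {l : ι → ℝ} {l' : κ → ℝ} (hψ : HasSchmidt ψ l) (hφ : HasSchmidt φ l')
    (hl : ∑ i, l i = 1) (hl' : ∑ i, l' i = 1) (h : Accesses ψ φ) {t : ℝ} (ht : 0 ≤ t) :
    excess l t ≤ excess l' t := by
  obtain ⟨hl0, U, V, hU, hV, rfl⟩ := hψ
  obtain ⟨hl0', U', V', hU', hV', rfl⟩ := hφ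
  obtain ⟨Λ, hΛ, hΛe⟩ := h
  -- Keeping exactly the entries above `t` makes the truncation error equal to `1 - excess l t - t *
  -- S.card`, the same shape as the lower bound for the target.
  let S : Finset ι := Finset.univ.filter fun i => t < l i
  obtain ⟨ν, hν, hνe⟩ := exists_rank_le_frobSq_sub_eq hl0 U V hU hV S
  obtain ⟨J, _, χ, μ, h1, h2, h3⟩ := hΛ.exists_ensemble
    (U * Matrix.diagonal (fun i => (Real.sqrt (l i) : ℂ)) * V.transpose) ν
  have hunit : frobSq (U' * Matrix.diagonal (fun i => (Real.sqrt (l' i) : ℂ)) * V'.transpose)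
      = 1 := by
    -- Truncation to no indices at all: the approximant has rank zero, so the error is the squared
    -- norm itself.
    obtain ⟨ν', hr, he⟩ := exists_rank_le_frobSq_sub_eq hl0' U' V' hU' hV' ∅
    have : ν' = 0 := by
      rw [Finset.card_empty, Nat.le_zero] at hr
      obtain ⟨Q, -, hQ⟩ := exists_isometry_mul_eq ν'
      rw [← hQ]
      ext a b
      have : IsEmpty (Fin ν'.rank) := by rw [hr]; infer_instance
      simp [Matrix.mul_apply]
    rw [this, sub_zero, hl', Finset.sum_empty, sub_zero] at he
    exact he
  obtain ⟨c, hc, hc1⟩ := exists_smul_of_sum_ketbra_eq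
    (by rw [star_dotProduct_bipartiteVec, hunit, Complex.ofReal_one]) (h1.symm.trans hΛe)
  have h4 : ∀ j, ‖c j‖ ^ 2 * (1 - excess l' t - t * S.card) ≤ frobSq (χ j - μ j) := by
    intro j
    have h5 : χ j = c j • (U' * Matrix.diagonal (fun i => (Real.sqrt (l' i) : ℂ)) *
        V'.transpose) := by
      ext a b
      exact congrFun (hc j) (a, b)
    have h6 := le_frobSq_sub hl0' U' V' hU' hV' (c j) (μ j) ht
    rw [h5]
    refine le_trans (mul_le_mul_of_nonneg_left ?_ (by positivity)) h6
    rw [hl']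
    have h7 : ((μ j).rank : ℝ) ≤ S.card := by exact_mod_cast (h2 j).trans hν
    have := mul_le_mul_of_nonneg_left h7 ht
    linarith
  have h8 := Finset.sum_le_sum fun j (_ : j ∈ Finset.univ) => h4 j
  rw [← Finset.sum_mul, hc1, one_mul, h3, hνe, hl] at h8
  have h9 : excess l t = ∑ i ∈ S, l i - t * S.card := by
    have h10 : ∀ i, max (l i - t) 0 = if t < l i then l i - t else 0 := by
      intro i
      split_ifs with hi
      · exact max_eq_left (by linarith)
      · exact max_eq_right (by linarith)
    rw [excess, Finset.sum_congr rfl fun i _ => h10 i, ← Finset.sum_filter,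
      Finset.sum_sub_distrib]
    simp [S, mul_comm]
  linarith

end Necessity

/-! ### Majorization and mixtures of rearrangements -/

section Majorization

/-- Abel summation: domination of partial sums passes to sums weighted by a decreasing family. -/
theorem sum_mul_le_sum_mul_of_antitone {n : ℕ} {w x y : ℕ → ℝ}
    (hw : ∀ i, i + 1 < n → w (i + 1) ≤ w i)
    (h : ∀ k < n, ∑ i ∈ Finset.range k, x i ≤ ∑ i ∈ Finset.range k, y i)
    (hn : ∑ i ∈ Finset.range n, x i = ∑ i ∈ Finset.range n, y i) :
    ∑ i ∈ Finset.range n, w i * x i ≤ ∑ i ∈ Finset.range n, w i * y i := by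
  have e := fun z : ℕ → ℝ => Finset.sum_range_by_parts w z n
  simp only [smul_eq_mul] at e
  rw [e, e, hn]
  refine sub_le_sub_left (Finset.sum_le_sum fun i hi => ?_) _
  rw [Finset.mem_range] at hi
  exact mul_le_mul_of_nonpos_left (h _ (by omega)) (sub_nonpos.2 (hw i (by omega)))

theorem sum_le_excess_add {ι : Type} [Fintype ι] (x : ι → ℝ) (S : Finset ι) (t : ℝ) :
    ∑ i ∈ S, x i ≤ excess x t + S.card * t := by
  have h : ∑ i ∈ S, (x i - t) ≤ excess x t :=
    (Finset.sum_le_sum fun i _ => le_max_left (x i - t) 0).trans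
      (Finset.sum_le_sum_of_subset_of_nonneg (Finset.subset_univ _)
        fun _ _ _ => le_max_right _ _)
  rw [Finset.sum_sub_distrib, Finset.sum_const, nsmul_eq_mul] at h
  linarith

theorem exists_antitone_comp {n : ℕ} (w : Fin n → ℝ) : ∃ τ : Equiv.Perm (Fin n), Antitone (w ∘ τ) := by
  refine ⟨Tuple.sort (fun i => -w i), fun i j hij => ?_⟩
  have := Tuple.monotone_sort (fun i => -w i) hij
  simpa using this

/-- By rearrangement, the best `σ` pairs large weights with large entries of `y`. Abel summation
then reduces the inequality to partial sums, and these are controlled by the excesses. -/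
theorem exists_perm_sum_mul_le {n : ℕ} {x y : Fin n → ℝ} (hy : ∀ i, 0 ≤ y i)
    (hsum : ∑ i, x i = ∑ i, y i) (h : ∀ t, 0 ≤ t → excess x t ≤ excess y t) (w : Fin n → ℝ) :
    ∃ σ : Equiv.Perm (Fin n), ∑ i, w i * x i ≤ ∑ i, w i * y (σ i) := by
  obtain ⟨τ, hτ⟩ := exists_antitone_comp w
  obtain ⟨ρ, hρ⟩ := exists_antitone_comp y
  refine ⟨τ.symm.trans ρ, ?_⟩
  rw [← Equiv.sum_comp τ, ← Equiv.sum_comp τ (fun i => w i * y ((τ.symm.trans ρ) i))]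
  simp only [Equiv.trans_apply, Equiv.symm_apply_apply]
  -- Extension by zero may break monotonicity past the end when weights are negative; Abel summation
  -- asks for it only while `i + 1 < n`.
  let ext : (Fin n → ℝ) → ℕ → ℝ := fun f i => if h : i < n then f ⟨i, h⟩ else 0
  have hext : ∀ (f : Fin n → ℝ) (i : Fin n), ext f i = f i := fun f i => by simp [ext]
  have hpart : ∀ (f : Fin n → ℝ) (k : ℕ), k ≤ n → ∑ i ∈ Finset.range k, ext f i =
      ∑ i ∈ Finset.univ.filter (fun i : Fin n => (i : ℕ) < k), f i := by
    intro f k hk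
    symm
    refine Finset.sum_bij (fun i _ => (i : ℕ)) ?_ ?_ ?_ ?_
    · intro i hi; simpa using hi
    · intro i _ j _ hij; exact Fin.ext hij
    · intro i hi
      rw [Finset.mem_range] at hi
      exact ⟨⟨i, by omega⟩, by simpa using hi, rfl⟩
    · intro i _; exact (hext f i).symm
  have key := sum_mul_le_sum_mul_of_antitone (n := n) (w := ext (w ∘ τ)) (x := ext (x ∘ τ))
    (y := ext (y ∘ ρ)) ?_ ?_ ?_
  · rw [← Fin.sum_univ_eq_sum_range (fun i => ext (w ∘ τ) i * ext (x ∘ τ) i),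
      ← Fin.sum_univ_eq_sum_range (fun i => ext (w ∘ τ) i * ext (y ∘ ρ) i)] at key
    simpa only [hext, Function.comp_apply] using key
  · intro i hi
    have h1 := hext (w ∘ τ) ⟨i + 1, hi⟩
    have h2 := hext (w ∘ τ) ⟨i, by omega⟩
    simp only at h1 h2
    rw [h1, h2]
    exact hτ (Fin.mk_le_mk.2 (by omega))
  · intro k hk
    rw [hpart _ k hk.le, hpart _ k hk.le]
    set S := Finset.univ.filter (fun i : Fin n => (i : ℕ) < k)
    -- At this threshold the excess of `y` is exactly the sum of its `k` largest entries minus `k *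
    -- t`; ties with `t` contribute zero.
    set t := y (ρ ⟨k, hk⟩)
    have ht : 0 ≤ t := hy _
    have h1 := sum_le_excess_add (x ∘ τ) S t
    have h2 : excess (x ∘ τ) t = excess x t := Equiv.sum_comp τ (fun i => max (x i - t) 0)
    have h3 : excess (y ∘ ρ) t = excess y t := Equiv.sum_comp ρ (fun i => max (y i - t) 0)
    have h4 : excess (y ∘ ρ) t = ∑ i ∈ S, (y ∘ ρ) i - S.card * t := by
      have h5 : ∀ i, max ((y ∘ ρ) i - t) 0 = if (i : ℕ) < k then (y ∘ ρ) i - t else 0 := by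
        intro i
        split_ifs with hi
        · exact max_eq_left (sub_nonneg.2 (hρ (Fin.le_def.2 hi.le)))
        · exact max_eq_right (sub_nonpos.2 (hρ (Fin.le_def.2 (not_lt.1 hi))))
      rw [excess, Finset.sum_congr rfl fun i _ => h5 i, ← Finset.sum_filter,
        Finset.sum_sub_distrib]
      simp [S]
    have h6 := h t ht
    linarith
  · rw [hpart _ n le_rfl, hpart _ n le_rfl]
    simp only [Fin.is_lt, Finset.filter_true]
    simpa only [Function.comp_def, Equiv.sum_comp τ x, Equiv.sum_comp ρ y] using hsum

/-- A point outside the closed convex hull of the rearrangements would be strictly separated from it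
by a linear functional. Taking the coefficients of that functional as weights,
`exists_perm_sum_mul_le` supplies a rearrangement contradicting the separation. -/
theorem mem_convexHull_perm {n : ℕ} {x y : Fin n → ℝ} (hy : ∀ i, 0 ≤ y i)
    (hsum : ∑ i, x i = ∑ i, y i) (h : ∀ t, 0 ≤ t → excess x t ≤ excess y t) :
    x ∈ convexHull ℝ (Set.range fun σ : Equiv.Perm (Fin n) => y ∘ σ) := by
  by_contra hx
  obtain ⟨f, u, hf, hu⟩ := geometric_hahn_banach_closed_point (convex_convexHull ℝ _)
    ((Set.finite_range _).isClosed_convexHull ℝ) hx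
  have hrep : ∀ z : Fin n → ℝ, f z = ∑ i, f (Pi.single i 1) * z i := by
    intro z
    conv_lhs => rw [← Finset.univ_sum_single z]
    rw [map_sum]
    refine Finset.sum_congr rfl fun i _ => ?_
    rw [mul_comm, ← smul_eq_mul, ← map_smul, ← Pi.single_smul, smul_eq_mul, mul_one]
  obtain ⟨σ, hσ⟩ := exists_perm_sum_mul_le hy hsum h fun i => f (Pi.single i 1)
  have h1 := hf _ (subset_convexHull ℝ _ ⟨σ, rfl⟩)
  rw [hrep] at h1 hu
  simp only [Function.comp_apply] at h1
  linarith

/-- A majorized vector is a mixture of rearrangements of the majorizing one. -/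
theorem exists_mixture_of_excess_le {ι κ : Type} [Fintype ι] [Fintype κ] [DecidableEq ι]
    {x : ι → ℝ} {y : κ → ℝ} (hy : ∀ j, 0 ≤ y j) (hcard : Fintype.card κ ≤ Fintype.card ι)
    (hsum : ∑ i, x i = ∑ j, y j) (h : ∀ t, 0 ≤ t → excess x t ≤ excess y t) :
    ∃ (T : Type) (_ : Fintype T) (p : T → ℝ) (τ : T → κ ↪ ι), (∀ k, 0 ≤ p k) ∧ ∑ k, p k = 1 ∧
      ∀ i, ∑ k, p k * ∑ j, (if τ k j = i then y j else 0) = x i := by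
  classical
  let e := Fintype.equivFin ι
  obtain ⟨g⟩ : Nonempty (κ ↪ Fin (Fintype.card ι)) :=
    Function.Embedding.nonempty_of_card_le (by simpa using hcard)
  -- Padding `y` with zeros to the length of `x`. This changes neither the total nor any excess at
  -- `t ≥ 0`, because the summed function vanishes at `0`.
  let y' : Fin (Fintype.card ι) → ℝ := fun i => ∑ j, if g j = i then y j else 0
  have hF : ∀ F : ℝ → ℝ, F 0 = 0 → ∑ i, F (y' i) = ∑ j, F (y j) := by
    intro F hF0
    have h1 : ∀ i, F (y' i) = ∑ j, if g j = i then F (y j) else 0 := by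
      intro i
      by_cases hi : ∃ j, g j = i
      · obtain ⟨j, rfl⟩ := hi
        simp [y', g.injective.eq_iff]
      · push Not at hi
        simp [y', hi, hF0]
    rw [Finset.sum_congr rfl fun i _ => h1 i, Finset.sum_comm]
    simp
  have hy'0 : ∀ i, 0 ≤ y' i := fun i =>
    Finset.sum_nonneg fun j _ => by split_ifs; exacts [hy j, le_rfl]
  have hm := mem_convexHull_perm (x := x ∘ e.symm) (y := y') hy'0
    ((Equiv.sum_comp e.symm x).trans (hsum.trans (hF id rfl).symm))
    (fun t ht => by
      have h1 : excess y' t = excess y t :=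
        hF (fun s => max (s - t) 0) (max_eq_right (by linarith))
      have h2 : excess (x ∘ e.symm) t = excess x t :=
        Equiv.sum_comp e.symm (fun i => max (x i - t) 0)
      rw [h1, h2]
      exact h t ht)
  rw [mem_convexHull_iff_exists_fintype] at hm
  obtain ⟨T, hT, p, z, hp, hp1, hz, hx⟩ := hm
  choose σ hσ using hz
  refine ⟨T, hT, p, fun k => (g.trans (σ k).symm.toEmbedding).trans e.symm.toEmbedding, hp, hp1,
    fun i => ?_⟩
  have h1 := congrFun hx (e i)
  simp only [Finset.sum_apply, Pi.smul_apply, smul_eq_mul, Function.comp_apply,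
    Equiv.symm_apply_apply] at h1
  rw [← h1]
  refine Finset.sum_congr rfl fun k _ => ?_
  rw [← hσ]
  simp only [y', Function.comp_apply, Function.Embedding.trans_apply, Equiv.coe_toEmbedding,
    Equiv.symm_apply_eq]

end Majorization

/-! ### Sufficiency of majorization: the one-way protocol -/

section Sufficiency

set_option linter.unusedSectionVars false

variable {A B C D ι κ K : Type} [Fintype A] [DecidableEq A] [Fintype B] [DecidableEq B]
  [Fintype C] [DecidableEq C] [Fintype D] [DecidableEq D] [Fintype ι] [DecidableEq ι]
  [Fintype κ] [DecidableEq κ] [Fintype K]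

/-- Completion of Kraus operators that sum to a projection `W * Wᴴ`: the complement is measured
and replaced by a fixed basis state. -/
noncomputable def completeKraus (c : C) (E : K → Matrix C A ℂ) (W : Matrix A ι ℂ) : K ⊕ A → Matrix C A ℂ :=
  Sum.elim E fun a => Matrix.single c a (1 : ℂ) * (1 - W * W.conjTranspose)

theorem sum_completeKraus (c : C) (E : K → Matrix C A ℂ) (W : Matrix A ι ℂ)
    (hW : W.conjTranspose * W = 1)
    (hE : ∑ k, (E k).conjTranspose * E k = W * W.conjTranspose) :
    ∑ k, (completeKraus c E W k).conjTranspose * completeKraus c E W k = 1 := by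
  have h1 : ∀ a : A, (Matrix.single c a (1 : ℂ)).conjTranspose * Matrix.single c a (1 : ℂ)
      = Matrix.single a a 1 := by
    intro a
    simp [Matrix.conjTranspose_single]
  have h2 : ∀ a : A, (completeKraus c E W (Sum.inr a)).conjTranspose *
      completeKraus c E W (Sum.inr a) = (1 - W * W.conjTranspose).conjTranspose *
        Matrix.single a a 1 * (1 - W * W.conjTranspose) := by
    intro a
    simp only [completeKraus, Sum.elim_inr, Matrix.conjTranspose_mul, ← h1]
    simp only [Matrix.mul_assoc]
  rw [Fintype.sum_sum_type, Finset.sum_congr rfl fun a _ => h2 a, ← Matrix.sum_mul,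
    ← Matrix.mul_sum, Matrix.sum_single_one, Matrix.mul_one, compl_mul_compl W hW]
  simp [completeKraus, hE]

/-- The matrix of `j ↦ τ j`. -/
def embeddingMatrix (τ : κ ↪ ι) : Matrix κ ι ℂ := fun j i => if τ j = i then 1 else 0

theorem embeddingMatrix_mul_transpose (τ : κ ↪ ι) :
    embeddingMatrix τ * (embeddingMatrix τ).transpose = 1 := by
  ext j j'
  simp [Matrix.mul_apply, embeddingMatrix, Matrix.one_apply, eq_comm]

theorem conjTranspose_embeddingMatrix (τ : κ ↪ ι) :
    (embeddingMatrix τ).conjTranspose = (embeddingMatrix τ).transpose := by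
  ext i j
  by_cases h : τ j = i <;> simp [embeddingMatrix, h]

theorem compl_mul_self (W : Matrix A ι ℂ) (hW : W.conjTranspose * W = 1) (X : Matrix ι B ℂ) :
    (1 - W * W.conjTranspose) * (W * X) = 0 := by
  rw [Matrix.sub_mul, Matrix.mul_assoc, ← Matrix.mul_assoc W.conjTranspose, hW, Matrix.one_mul,
    Matrix.one_mul, sub_self]

/-- The operators by which the second party moves the basis `V` to `V'` along `τ`. -/
noncomputable def transferKraus (d : D) (V : Matrix B ι ℂ) (V' : Matrix D κ ℂ) (τ : κ ↪ ι) :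
    Unit ⊕ B → Matrix D B ℂ :=
  completeKraus d (fun _ => V' * embeddingMatrix τ * V.conjTranspose)
    (V * (embeddingMatrix τ).transpose)

theorem isometry_mul_embedding (V : Matrix B ι ℂ) (hV : V.conjTranspose * V = 1) (τ : κ ↪ ι) :
    (V * (embeddingMatrix τ).transpose).conjTranspose * (V * (embeddingMatrix τ).transpose)
      = 1 := by
  rw [Matrix.conjTranspose_mul, ← conjTranspose_embeddingMatrix, Matrix.conjTranspose_conjTranspose,
    Matrix.mul_assoc, ← Matrix.mul_assoc V.conjTranspose, hV, Matrix.one_mul,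
    conjTranspose_embeddingMatrix, embeddingMatrix_mul_transpose]

theorem sum_transferKraus (d : D) (V : Matrix B ι ℂ) (V' : Matrix D κ ℂ) (τ : κ ↪ ι)
    (hV : V.conjTranspose * V = 1) (hV' : V'.conjTranspose * V' = 1) :
    ∑ k, (transferKraus d V V' τ k).conjTranspose * transferKraus d V V' τ k = 1 := by
  refine sum_completeKraus d _ _ (isometry_mul_embedding V hV τ) ?_
  simp only [Finset.univ_unique, Finset.sum_singleton, Matrix.conjTranspose_mul,
    Matrix.conjTranspose_conjTranspose, ← conjTranspose_embeddingMatrix]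
  have h : V * ((embeddingMatrix τ).conjTranspose * V'.conjTranspose) *
      (V' * embeddingMatrix τ * V.conjTranspose) = V * ((embeddingMatrix τ).conjTranspose *
        ((V'.conjTranspose * V') * (embeddingMatrix τ * V.conjTranspose))) := by
    simp only [Matrix.mul_assoc]
  rw [h, hV', Matrix.one_mul]
  simp only [Matrix.mul_assoc]

theorem isLOCC_transfer (d : D) (V : Matrix B ι ℂ) (V' : Matrix D κ ℂ) (τ : κ ↪ ι)
    (hV : V.conjTranspose * V = 1) (hV' : V'.conjTranspose * V' = 1) :
    IsLOCC C D C B (fun ρ => ∑ k, (((1 : Matrix C C ℂ) ⊗ₖ transferKraus d V V' τ k) * ρ *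
      ((1 : Matrix C C ℂ) ⊗ₖ transferKraus d V V' τ k).conjTranspose)) :=
  IsLOCC.second (fun _ => D) _ (sum_transferKraus d V V' τ hV hV') (fun _ ρ => ρ)
    fun _ => IsLOCC.finish

theorem ketbra_bipartiteVec_smul (r : ℝ) (hr : 0 ≤ r) (M : Matrix A B ℂ) :
    ketbra (bipartiteVec ((Real.sqrt r : ℂ) • M)) = (r : ℂ) • ketbra (bipartiteVec M) := by
  ext p q
  have h : (Real.sqrt r : ℂ) * (Real.sqrt r : ℂ) = r := by
    rw [← Complex.ofReal_mul, Real.mul_self_sqrt hr]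
  simp only [ketbra, Matrix.vecMulVec_apply, bipartiteVec, Matrix.smul_apply, smul_eq_mul,
    Pi.star_apply, star_mul', RCLike.star_def, Complex.conj_ofReal]
  rw [← h]
  ring

theorem ketbra_bipartiteVec_zero : ketbra (bipartiteVec (0 : Matrix A B ℂ)) = 0 := by
  ext p q
  simp [ketbra, bipartiteVec, Matrix.vecMulVec_apply]

/-- The state is supported on the basis vectors of `V` selected by `τ`, so the complementary
outcomes have amplitude zero and the remaining one relabels those vectors to `V'`. -/
theorem transfer_apply (d : D) (V : Matrix B ι ℂ) (V' : Matrix D κ ℂ) (τ : κ ↪ ι)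
    (hV : V.conjTranspose * V = 1) (X : Matrix C κ ℂ) :
    ∑ k, (((1 : Matrix C C ℂ) ⊗ₖ transferKraus d V V' τ k) *
      ketbra (bipartiteVec (X * embeddingMatrix τ * V.transpose)) *
      ((1 : Matrix C C ℂ) ⊗ₖ transferKraus d V V' τ k).conjTranspose)
    = ketbra (bipartiteVec (X * V'.transpose)) := by
  simp only [mul_ketbra_mul, one_kronecker_mulVec]
  rw [Fintype.sum_sum_type]
  have h1 : ∀ b : B, X * embeddingMatrix τ * V.transpose *
      (transferKraus d V V' τ (Sum.inr b)).transpose = 0 := by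
    intro b
    have h2 := compl_mul_self _ (isometry_mul_embedding V hV τ) X.transpose
    have h3 : X * embeddingMatrix τ * V.transpose
        = (V * (embeddingMatrix τ).transpose * X.transpose).transpose := by
      simp only [Matrix.transpose_mul, Matrix.transpose_transpose, Matrix.mul_assoc]
    rw [h3, ← Matrix.transpose_mul, transferKraus, completeKraus, Sum.elim_inr, Matrix.mul_assoc,
      h2, Matrix.mul_zero, Matrix.transpose_zero]
  have h4 : X * embeddingMatrix τ * V.transpose *
      (transferKraus d V V' τ (Sum.inl ())).transpose = X * V'.transpose := by
    have h5 : X * embeddingMatrix τ * V.transpose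
        = (V * (embeddingMatrix τ).transpose * X.transpose).transpose := by
      simp only [Matrix.transpose_mul, Matrix.transpose_transpose, Matrix.mul_assoc]
    have h6 : V' * embeddingMatrix τ * V.conjTranspose *
        (V * (embeddingMatrix τ).transpose * X.transpose) = V' * (embeddingMatrix τ *
          ((V.conjTranspose * V) * ((embeddingMatrix τ).transpose * X.transpose))) := by
      simp only [Matrix.mul_assoc]
    rw [h5, ← Matrix.transpose_mul, transferKraus, completeKraus, Sum.elim_inl, h6, hV,
      Matrix.one_mul, ← Matrix.mul_assoc (embeddingMatrix τ), embeddingMatrix_mul_transpose,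
      Matrix.one_mul, Matrix.transpose_mul, Matrix.transpose_transpose]
  simp only [h1, ketbra_bipartiteVec_zero, Finset.univ_unique, Finset.sum_singleton,
    Finset.sum_const_zero, add_zero, PUnit.default_eq_unit, h4]

/-- Nielsen's theorem: majorization suffices for an LOCC transformation. -/
theorem accesses_of_excess_le {ψ : A × B → ℂ} {φ : C × D → ℂ} {l : ι → ℝ} {l' : κ → ℝ}
    (hψ : HasSchmidt ψ l) (hφ : HasSchmidt φ l') (hpos : ∀ i, 0 < l i)
    (hcard : Fintype.card κ ≤ Fintype.card ι) (hne : Nonempty κ)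
    (hsum : ∑ i, l i = ∑ j, l' j) (h : ∀ t, 0 ≤ t → excess l t ≤ excess l' t) :
    Accesses ψ φ := by
  obtain ⟨hl0, U, V, hU, hV, rfl⟩ := hψ
  obtain ⟨hl0', U', V', hU', hV', rfl⟩ := hφ
  obtain ⟨T, _, p, τ, hp, hp1, hmix⟩ := exists_mixture_of_excess_le hl0' hcard hsum h
  have hT : Nonempty T := by
    by_contra hT
    rw [not_nonempty_iff] at hT
    simp at hp1
  have hCD : Nonempty C ∧ Nonempty D := by
    obtain ⟨j⟩ := hne
    constructor <;> by_contra hC <;> rw [not_nonempty_iff] at hC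
    · simpa [Matrix.mul_apply] using congrFun (congrFun hU' j) j
    · simpa [Matrix.mul_apply] using congrFun (congrFun hV' j) j
  obtain ⟨⟨c⟩, ⟨d⟩⟩ := hCD
  obtain ⟨k₀⟩ := hT
  -- The entries are chosen so that `G k` turns `√(l i)` into `√(p k)` times the target coefficient.
  -- Completeness is then the mixture identity divided by `l i`, which is why the source
  -- coefficients must be positive.
  let G : T → Matrix κ ι ℂ := fun k => Matrix.of fun j i =>
    if τ k j = i then (Real.sqrt (p k * l' j / l i) : ℂ) else 0
  have hGG : ∑ k, (G k).conjTranspose * G k = 1 := by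
    ext i i'
    simp only [Matrix.sum_apply, Matrix.mul_apply, Matrix.conjTranspose_apply, Matrix.of_apply, G]
    by_cases hi : i = i'
    · subst hi
      have h1 : ∀ k j, star (if τ k j = i then (Real.sqrt (p k * l' j / l i) : ℂ) else 0) *
          (if τ k j = i then (Real.sqrt (p k * l' j / l i) : ℂ) else 0)
          = (((p k * (if τ k j = i then l' j else 0)) / l i : ℝ) : ℂ) := by
        intro k j
        split_ifs
        · rw [RCLike.star_def, Complex.conj_ofReal, ← Complex.ofReal_mul,
            Real.mul_self_sqrt (div_nonneg (mul_nonneg (hp k) (hl0' j)) (hl0 i))]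
        · simp
      simp only [h1, ← Complex.ofReal_sum, ← Finset.sum_div, ← Finset.mul_sum, hmix,
        div_self (hpos i).ne', Matrix.one_apply_eq, Complex.ofReal_one]
    · rw [Matrix.one_apply_ne hi]
      refine Finset.sum_eq_zero fun k _ => Finset.sum_eq_zero fun j _ => ?_
      by_cases h2 : τ k j = i
      · have h3 : τ k j ≠ i' := fun h3 => hi (h2.symm.trans h3)
        simp [h3]
      · simp [h2]
  have hGD : ∀ k, G k * Matrix.diagonal (fun i => (Real.sqrt (l i) : ℂ)) =
      (Real.sqrt (p k) : ℂ) • (Matrix.diagonal (fun j => (Real.sqrt (l' j) : ℂ)) *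
        embeddingMatrix (τ k)) := by
    intro k
    ext j i
    rw [Matrix.mul_diagonal, Matrix.smul_apply, Matrix.diagonal_mul]
    simp only [G, embeddingMatrix, Matrix.of_apply]
    split_ifs
    · rw [smul_eq_mul, mul_one, ← Complex.ofReal_mul, ← Complex.ofReal_mul,
        ← Real.sqrt_mul (hp k), ← Real.sqrt_mul
          (div_nonneg (mul_nonneg (hp k) (hl0' j)) (hl0 i)), div_mul_cancel₀ _ (hpos i).ne']
    · simp
  have hE : ∑ k, (U' * G k * U.conjTranspose).conjTranspose * (U' * G k * U.conjTranspose)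
      = U * U.conjTranspose := by
    have h1 : ∀ k, (U' * G k * U.conjTranspose).conjTranspose * (U' * G k * U.conjTranspose)
        = U * ((G k).conjTranspose * G k) * U.conjTranspose := by
      intro k
      rw [Matrix.conjTranspose_mul, Matrix.conjTranspose_mul, Matrix.conjTranspose_conjTranspose]
      have h2 : U * ((G k).conjTranspose * U'.conjTranspose) * (U' * G k * U.conjTranspose)
          = U * ((G k).conjTranspose * ((U'.conjTranspose * U') * (G k * U.conjTranspose))) := by
        simp only [Matrix.mul_assoc]
      rw [h2, hU', Matrix.one_mul]
      simp only [Matrix.mul_assoc]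
    rw [Finset.sum_congr rfl fun k _ => h1 k, ← Matrix.sum_mul, ← Matrix.mul_sum, hGG,
      Matrix.mul_one]
  refine ⟨_, IsLOCC.first (fun _ => C) (completeKraus c (fun k => U' * G k * U.conjTranspose) U)
    (sum_completeKraus c _ U hU hE) _
    (fun k => isLOCC_transfer d V V' (Sum.elim τ (fun _ => τ k₀) k) hV hV'), ?_⟩
  have hinl : ∀ k, completeKraus c (fun k => U' * G k * U.conjTranspose) U (Sum.inl k) *
      (U * Matrix.diagonal (fun i => (Real.sqrt (l i) : ℂ)) * V.transpose)
      = ((Real.sqrt (p k) : ℂ) • (U' * Matrix.diagonal (fun j => (Real.sqrt (l' j) : ℂ)))) *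
        embeddingMatrix (τ k) * V.transpose := by
    intro k
    have h2 : U' * G k * U.conjTranspose *
        (U * Matrix.diagonal (fun i => (Real.sqrt (l i) : ℂ)) * V.transpose)
        = U' * (G k * ((U.conjTranspose * U) *
          Matrix.diagonal (fun i => (Real.sqrt (l i) : ℂ)))) * V.transpose := by
      simp only [Matrix.mul_assoc]
    rw [completeKraus, Sum.elim_inl, h2, hU, Matrix.one_mul, hGD, Matrix.mul_smul,
      Matrix.smul_mul, Matrix.smul_mul, Matrix.smul_mul, Matrix.mul_assoc]
    simp only [Matrix.mul_assoc]
  have hinr : ∀ a, completeKraus c (fun k => U' * G k * U.conjTranspose) U (Sum.inr a) *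
      (U * Matrix.diagonal (fun i => (Real.sqrt (l i) : ℂ)) * V.transpose) = 0 := by
    intro a
    rw [completeKraus, Sum.elim_inr, Matrix.mul_assoc, Matrix.mul_assoc U, compl_mul_self U hU,
      Matrix.mul_zero]
  rw [Fintype.sum_sum_type]
  simp only [mul_ketbra_mul (_ ⊗ₖ (1 : Matrix B B ℂ)), kronecker_one_mulVec, hinl, hinr,
    ketbra_bipartiteVec_zero, Sum.elim_inl, transfer_apply d V V' _ hV]
  simp only [Matrix.mul_zero, Matrix.zero_mul, Finset.sum_const_zero, add_zero, Matrix.smul_mul]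
  rw [Finset.sum_congr rfl fun k _ => ketbra_bipartiteVec_smul (p k) (hp k) _, ← Finset.sum_smul,
    ← Complex.ofReal_sum, hp1, Complex.ofReal_one, one_smul]

end Sufficiency

/-! ### Schmidt coefficients of tensor products and powers -/

section SchmidtCoefficients

set_option linter.unusedSectionVars false

variable {A B C D ι κ : Type} [Fintype A] [Fintype B] [Fintype C] [Fintype D] [Fintype ι]
  [DecidableEq ι] [Fintype κ] [DecidableEq κ]

theorem IsSchmidtVector.hasSchmidt {n : ℕ} {ψ : A × B → ℂ} {l : Fin n → ℝ}
    (h : IsSchmidtVector ψ l) : HasSchmidt ψ l := by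
  obtain ⟨-, h0, -, u, v, hu, hv, hψ⟩ := h
  have key : ∀ {X : Type} [Fintype X] (u : Fin n → EuclideanSpace ℂ X), Orthonormal ℂ u →
      (Matrix.of fun a i => u i a).conjTranspose * (Matrix.of fun a i => u i a) = 1 := by
    intro X _ u hu
    ext i j
    have h := orthonormal_iff_ite.1 hu i j
    rw [EuclideanSpace.inner_eq_star_dotProduct] at h
    rw [Matrix.one_apply, ← h, Matrix.mul_apply, dotProduct]
    exact Finset.sum_congr rfl fun a _ => by simp [mul_comm]
  refine ⟨h0, _, _, key u hu, key v hv, ?_⟩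
  ext ⟨a, b⟩
  rw [hψ, bipartiteVec, Matrix.mul_apply]
  refine Finset.sum_congr rfl fun i _ => ?_
  simp [Matrix.mul_diagonal, mul_comm]

theorem HasSchmidt.tensorState {ψ : A × B → ℂ} {φ : C × D → ℂ} {l : ι → ℝ} {l' : κ → ℝ}
    (hψ : HasSchmidt ψ l) (hφ : HasSchmidt φ l') :
    HasSchmidt (tensorState ψ φ) (fun p : ι × κ => l p.1 * l' p.2) := by
  obtain ⟨h0, U, V, hU, hV, rfl⟩ := hψ
  obtain ⟨h0', U', V', hU', hV', rfl⟩ := hφ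
  refine ⟨fun p => mul_nonneg (h0 _) (h0' _), U ⊗ₖ U', V ⊗ₖ V', ?_, ?_, ?_⟩
  · rw [Matrix.conjTranspose_kronecker, ← Matrix.mul_kronecker_mul, hU, hU', Matrix.one_kronecker_one]
  · rw [Matrix.conjTranspose_kronecker, ← Matrix.mul_kronecker_mul, hV, hV', Matrix.one_kronecker_one]
  · have h1 : Matrix.diagonal (fun p : ι × κ => (Real.sqrt (l p.1 * l' p.2) : ℂ)) =
        Matrix.diagonal (fun i => (Real.sqrt (l i) : ℂ)) ⊗ₖ
          Matrix.diagonal (fun i => (Real.sqrt (l' i) : ℂ)) := by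
      rw [Matrix.diagonal_kronecker_diagonal]
      congr 1
      ext p
      rw [Real.sqrt_mul (h0 _), Complex.ofReal_mul]
    have h2 : (V ⊗ₖ V').transpose = V.transpose ⊗ₖ V'.transpose := rfl
    rw [h1, h2, ← Matrix.mul_kronecker_mul, ← Matrix.mul_kronecker_mul]
    rfl

/-- The `k`-fold Kronecker power of a matrix. -/
def kroneckerPow (k : ℕ) (U : Matrix A ι ℂ) : Matrix (Fin k → A) (Fin k → ι) ℂ :=
  Matrix.of fun f g => ∏ i, U (f i) (g i)

theorem kroneckerPow_mul (k : ℕ) (X : Matrix A B ℂ) (Y : Matrix B C ℂ) :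
    kroneckerPow k X * kroneckerPow k Y = kroneckerPow k (X * Y) := by
  classical
  ext f g
  simp only [kroneckerPow, Matrix.mul_apply, Matrix.of_apply, ← Finset.prod_mul_distrib,
    Finset.prod_univ_sum, Fintype.piFinset_univ]

theorem kroneckerPow_diagonal (k : ℕ) (d : ι → ℂ) :
    kroneckerPow k (Matrix.diagonal d) = Matrix.diagonal fun f : Fin k → ι => ∏ i, d (f i) := by
  ext f g
  rw [kroneckerPow, Matrix.of_apply]
  by_cases h : f = g
  · subst h; simp
  · rw [Matrix.diagonal_apply_ne _ h]
    obtain ⟨i, hi⟩ := Function.ne_iff.1 h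
    exact Finset.prod_eq_zero (Finset.mem_univ i) (Matrix.diagonal_apply_ne _ hi)

theorem kroneckerPow_isometry (k : ℕ) {U : Matrix A ι ℂ} (hU : U.conjTranspose * U = 1) :
    (kroneckerPow k U).conjTranspose * kroneckerPow k U = 1 := by
  have h : (kroneckerPow k U).conjTranspose = kroneckerPow k U.conjTranspose := by
    ext f g
    simp [kroneckerPow]
  rw [h, kroneckerPow_mul, hU, ← Matrix.diagonal_one, kroneckerPow_diagonal]
  simp

theorem HasSchmidt.copies {ψ : A × B → ℂ} {l : ι → ℝ} (hψ : HasSchmidt ψ l) (k : ℕ) :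
    HasSchmidt (copies k ψ) (fun f : Fin k → ι => ∏ i, l (f i)) := by
  classical
  obtain ⟨h0, U, V, hU, hV, rfl⟩ := hψ
  refine ⟨fun f => Finset.prod_nonneg fun i _ => h0 _, kroneckerPow k U, kroneckerPow k V,
    kroneckerPow_isometry k hU, kroneckerPow_isometry k hV, ?_⟩
  have h1 : Matrix.diagonal (fun f : Fin k → ι => (Real.sqrt (∏ i, l (f i)) : ℂ)) =
      kroneckerPow k (Matrix.diagonal fun i => (Real.sqrt (l i) : ℂ)) := by
    rw [kroneckerPow_diagonal]
    congr 1
    ext f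
    rw [Real.sqrt_eq_rpow, ← Real.finsetProd_rpow _ _ fun i _ => h0 _, Complex.ofReal_prod]
    simp only [Real.sqrt_eq_rpow]
  have h2 : (kroneckerPow k V).transpose = kroneckerPow k V.transpose := rfl
  rw [h1, h2, kroneckerPow_mul, kroneckerPow_mul]
  rfl

end SchmidtCoefficients

/-! ### Reduction to finitely many integer thresholds -/

section Thresholds

variable {ι κ : Type} [Fintype ι] [Fintype κ]

/-- The excesses of `x` are dominated by those of `y` as soon as this holds at the entries of `y`
and at `0`. -/
theorem excess_le_of_breakpoints {x : ι → ℝ} {y : κ → ℝ} (h0 : excess x 0 ≤ excess y 0)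
    (h : ∀ j, excess x (y j) ≤ excess y (y j)) {t : ℝ} (ht : 0 ≤ t) :
    excess x t ≤ excess y t := by
  classical
  -- Including `0` guarantees a breakpoint at or below every `t ≥ 0`.
  let S : Finset ℝ := insert 0 (Finset.univ.image y)
  have hS : ∀ s ∈ S, excess x s ≤ excess y s := by
    intro s hs
    rcases Finset.mem_insert.1 hs with rfl | hs
    · exact h0
    · obtain ⟨j, -, rfl⟩ := Finset.mem_image.1 hs
      exact h j
  have hyS : ∀ j, y j ∈ S := fun j => by simp [S]
  obtain ⟨a, ha, hamax⟩ := (S.filter (· ≤ t)).exists_max_image id ⟨0, by simp [S, ht]⟩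
  rw [Finset.mem_filter] at ha
  have hlow : ∀ j, y j ≤ t → y j ≤ a := fun j hj =>
    hamax _ (Finset.mem_filter.2 ⟨hyS j, hj⟩)
  by_cases hne : (S.filter (t < ·)).Nonempty
  · obtain ⟨b, hb, hbmin⟩ := (S.filter (t < ·)).exists_min_image id hne
    rw [Finset.mem_filter] at hb
    have hhigh : ∀ j, t < y j → b ≤ y j := fun j hj =>
      hbmin _ (Finset.mem_filter.2 ⟨hyS j, hj⟩)
    have hab : 0 < b - a := by linarith [ha.2, hb.2]
    -- Between consecutive breakpoints `a` and `b`, the excess of `x` lies below its chord by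
    -- convexity, while that of `y` coincides with its chord.
    have hx : (b - a) * excess x t ≤ (b - t) * excess x a + (t - a) * excess x b := by
      simp only [excess, Finset.mul_sum, ← Finset.sum_add_distrib]
      refine Finset.sum_le_sum fun i _ => ?_
      have h1 := mul_le_mul_of_nonneg_left (le_max_left (x i - a) 0) (sub_nonneg.2 hb.2.le)
      have h2 := mul_le_mul_of_nonneg_left (le_max_left (x i - b) 0) (sub_nonneg.2 ha.2)
      have h3 := mul_nonneg (sub_nonneg.2 hb.2.le) (le_max_right (x i - a) 0)
      have h4 := mul_nonneg (sub_nonneg.2 ha.2) (le_max_right (x i - b) 0)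
      rcases max_cases (x i - t) 0 with ⟨he, -⟩ | ⟨he, -⟩ <;> rw [he] <;> linarith
    have hy : (b - a) * excess y t = (b - t) * excess y a + (t - a) * excess y b := by
      simp only [excess, Finset.mul_sum, ← Finset.sum_add_distrib]
      refine Finset.sum_congr rfl fun j _ => ?_
      rcases le_or_gt (y j) t with hj | hj
      · have := hlow j hj
        rw [max_eq_right (by linarith), max_eq_right (by linarith), max_eq_right (by linarith)]
        ring
      · have := hhigh j hj
        rw [max_eq_left (by linarith), max_eq_left (by linarith), max_eq_left (by linarith)]
        ring
    have h1 := mul_le_mul_of_nonneg_left (hS a ha.1) (sub_nonneg.2 hb.2.le)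
    have h2 := mul_le_mul_of_nonneg_left (hS b (Finset.mem_filter.1 (by simpa using hb)).1)
      (sub_nonneg.2 ha.2)
    exact le_of_mul_le_mul_left (by linarith) hab
  -- Beyond the last breakpoint the excess of `y` is zero, already at `a`, and the excess of `x`
  -- decreases in the threshold.
  · have hle : ∀ j, y j ≤ t := fun j => by
      by_contra hj
      exact hne ⟨y j, Finset.mem_filter.2 ⟨hyS j, not_le.1 hj⟩⟩
    have hy : excess y a = 0 := Finset.sum_eq_zero fun j _ =>
      max_eq_right (sub_nonpos.2 (hlow j (hle j)))
    have hx : excess x t ≤ excess x a := Finset.sum_le_sum fun i _ =>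
      max_le_max_right _ (by linarith [ha.2])
    have hyt : 0 ≤ excess y t := Finset.sum_nonneg fun _ _ => le_max_right _ _
    linarith [hS a ha.1]

/-- The list `L` of values with multiplicities enumerates the entries of `a`. -/
def Enumerates (L : List (ℕ × ℕ)) (a : ι → ℕ) : Prop :=
  ∀ g : ℕ → ℝ, ∑ i, g (a i) = (L.map fun p => (p.2 : ℝ) * g p.1).sum

/-- Add the value `v` with multiplicity `m`. -/
def addEntry (v m : ℕ) : List (ℕ × ℕ) → List (ℕ × ℕ)
  | [] => [(v, m)]
  | p :: L => if v = p.1 then (p.1, m + p.2) :: L else p :: addEntry v m L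

/-- All products of an entry of the first list with one of the second. -/
def mulEntries (L L' : List (ℕ × ℕ)) : List (ℕ × ℕ) :=
  L.foldr (fun p acc => L'.foldr (fun q acc => addEntry (p.1 * q.1) (p.2 * q.2) acc) acc) []

/-- All products of `k` entries. -/
def powEntries (L : List (ℕ × ℕ)) : ℕ → List (ℕ × ℕ)
  | 0 => [(1, 1)]
  | k + 1 => mulEntries L (powEntries L k)

theorem sum_addEntry (v m : ℕ) (L : List (ℕ × ℕ)) (g : ℕ → ℝ) :
    ((addEntry v m L).map fun p => (p.2 : ℝ) * g p.1).sum
      = m * g v + (L.map fun p => (p.2 : ℝ) * g p.1).sum := by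
  induction L with
  | nil => simp [addEntry]
  | cons p L ih =>
    rw [addEntry]
    split_ifs with h
    · simp only [List.map_cons, List.sum_cons, h]; push_cast; ring
    · simp only [List.map_cons, List.sum_cons, ih]; ring

theorem sum_mulEntries (L L' : List (ℕ × ℕ)) (g : ℕ → ℝ) :
    ((mulEntries L L').map fun p => (p.2 : ℝ) * g p.1).sum
      = (L.map fun p => (p.2 : ℝ) * (L'.map fun q => (q.2 : ℝ) * g (p.1 * q.1)).sum).sum := by
  have inner : ∀ (p : ℕ × ℕ) (L' acc : List (ℕ × ℕ)),
      ((L'.foldr (fun q acc => addEntry (p.1 * q.1) (p.2 * q.2) acc) acc).map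
        fun p => (p.2 : ℝ) * g p.1).sum
      = (p.2 : ℝ) * (L'.map fun q => (q.2 : ℝ) * g (p.1 * q.1)).sum
        + (acc.map fun p => (p.2 : ℝ) * g p.1).sum := by
    intro p L' acc
    induction L' with
    | nil => simp
    | cons q L' ih =>
      rw [List.foldr_cons, sum_addEntry, ih, List.map_cons, List.sum_cons]
      push_cast; ring
  induction L with
  | nil => simp [mulEntries]
  | cons p L ih =>
    rw [List.map_cons, List.sum_cons, ← ih]
    exact inner p L' (mulEntries L L')

theorem Enumerates.mul {L L' : List (ℕ × ℕ)} {a : ι → ℕ} {b : κ → ℕ} (ha : Enumerates L a)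
    (hb : Enumerates L' b) : Enumerates (mulEntries L L') (fun p : ι × κ => a p.1 * b p.2) := by
  intro g
  rw [sum_mulEntries, Fintype.sum_prod_type, ← ha fun v => (L'.map fun q => (q.2 : ℝ) *
    g (v * q.1)).sum]
  exact Finset.sum_congr rfl fun i _ => hb fun w => g (a i * w)

theorem Enumerates.pow {L : List (ℕ × ℕ)} {a : ι → ℕ} (ha : Enumerates L a) (k : ℕ) :
    Enumerates (powEntries L k) (fun f : Fin k → ι => ∏ i, a (f i)) := by
  induction k with
  | zero => intro g; simp [powEntries]
  | succ k ih =>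
    intro g
    rw [powEntries, ← ha.mul ih g, ← Equiv.sum_comp (Fin.consEquiv fun _ => ι)]
    refine Finset.sum_congr rfl fun p _ => ?_
    simp [Fin.prod_univ_succ, Fin.consEquiv]

/-- Test the enumeration on the indicator of `a i`: a missing value would give zero on the list side
but at least one on the other. -/
theorem Enumerates.mem {L : List (ℕ × ℕ)} {a : ι → ℕ} (ha : Enumerates L a) (i : ι) :
    ∃ p ∈ L, p.1 = a i := by
  by_contra! hL
  have h := ha fun v => if v = a i then 1 else 0
  have h1 : (L.map fun p => (p.2 : ℝ) * if p.1 = a i then 1 else 0).sum = 0 := by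
    refine List.sum_eq_zero fun r hr => ?_
    obtain ⟨p, hp, rfl⟩ := List.mem_map.1 hr
    simp [hL p hp]
  have h2 := Finset.single_le_sum (f := fun i' => if a i' = a i then (1 : ℝ) else 0)
    (fun _ _ => by split_ifs <;> norm_num) (Finset.mem_univ i)
  rw [h, h1] at h2
  norm_num at h2

/-- The excess over the threshold `s` of the entries listed in `L`. -/
def listExcess (L : List (ℕ × ℕ)) (s : ℕ) : ℕ := (L.map fun p => p.2 * (p.1 - s)).sum

/-- Truncated subtraction of natural numbers is the positive part, so excesses at thresholds `s / M`
are computed exactly in `ℕ`. -/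
theorem Enumerates.excess_div {L : List (ℕ × ℕ)} {a : ι → ℕ} (ha : Enumerates L a) {M : ℝ}
    (hM : 0 < M) (s : ℕ) :
    excess (fun i => (a i : ℝ) / M) (s / M) = (listExcess L s : ℝ) / M := by
  have h1 : ∀ v : ℕ, max ((v : ℝ) / M - s / M) 0 = ((v - s : ℕ) : ℝ) / M := by
    intro v
    rw [← sub_div]
    rcases le_total s v with h | h
    · rw [Nat.cast_sub h]
      exact max_eq_left (div_nonneg (sub_nonneg.2 (by exact_mod_cast h)) hM.le)
    · rw [Nat.sub_eq_zero_of_le h, Nat.cast_zero, zero_div]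
      exact max_eq_right (div_nonpos_of_nonpos_of_nonneg
        (sub_nonpos.2 (by exact_mod_cast h)) hM.le)
  simp only [excess, h1]
  rw [ha fun v => ((v - s : ℕ) : ℝ) / M, listExcess, Nat.cast_list_sum, List.map_map, div_eq_mul_inv,
    ← List.sum_map_mul_right]
  congr 1
  refine List.map_congr_left fun p _ => ?_
  simp only [Function.comp_apply]
  push_cast
  ring

theorem Enumerates.excess_le {L L' : List (ℕ × ℕ)} {a : ι → ℕ} {b : κ → ℕ}
    (ha : Enumerates L a) (hb : Enumerates L' b) {M : ℝ} (hM : 0 < M)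
    (h : ∀ s ∈ 0 :: L'.map Prod.fst, listExcess L s ≤ listExcess L' s) {t : ℝ} (ht : 0 ≤ t) :
    excess (fun i => (a i : ℝ) / M) t ≤ excess (fun j => (b j : ℝ) / M) t := by
  have key : ∀ s ∈ 0 :: L'.map Prod.fst,
      excess (fun i => (a i : ℝ) / M) (s / M) ≤ excess (fun j => (b j : ℝ) / M) (s / M) := by
    intro s hs
    rw [ha.excess_div hM, hb.excess_div hM]
    exact div_le_div_of_nonneg_right (by exact_mod_cast h s hs) hM.le
  refine excess_le_of_breakpoints ?_ (fun j => ?_) ht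
  · simpa using key 0 (by simp)
  · obtain ⟨p, hp, hpj⟩ := hb.mem j
    exact key (b j) (List.mem_cons_of_mem _ (List.mem_map.2 ⟨p, hp, hpj⟩))

theorem Enumerates.excess_lt {L L' : List (ℕ × ℕ)} {a : ι → ℕ} {b : κ → ℕ}
    (ha : Enumerates L a) (hb : Enumerates L' b) {M : ℝ} (hM : 0 < M) {s : ℕ}
    (h : listExcess L' s < listExcess L s) :
    excess (fun j => (b j : ℝ) / M) (s / M) < excess (fun i => (a i : ℝ) / M) (s / M) := by
  rw [ha.excess_div hM, hb.excess_div hM]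
  exact div_lt_div_of_pos_right (by exact_mod_cast h) hM

end Thresholds

/-! ### Criteria for a row in terms of integer lists -/

section Rows

/-- The real vector `a / 1000`. -/
noncomputable def perMille {n : ℕ} (a : Fin n → ℕ) : Fin n → ℝ := fun i => (a i : ℝ) / 1000

theorem sum_perMille_mul_prod {n m k : ℕ} {a : Fin n → ℕ} {b : Fin m → ℕ}
    (ha : ∑ i, perMille a i = 1) (hb : ∑ i, perMille b i = 1) :
    ∑ p : Fin m × (Fin k → Fin n), perMille b p.1 * ∏ i, perMille a (p.2 i) = 1 := by
  rw [Fintype.sum_prod_type]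
  simp only
  rw [← Finset.sum_mul_sum, hb, one_mul]
  have h := Finset.prod_univ_sum (fun _ : Fin k => Finset.univ) fun _ i => perMille a i
  rw [Fintype.piFinset_univ] at h
  rw [← h, ha, Finset.prod_const_one]

theorem perMille_mul_prod {n m k : ℕ} (a : Fin n → ℕ) (b : Fin m → ℕ) :
    (fun p : Fin m × (Fin k → Fin n) => perMille b p.1 * ∏ i, perMille a (p.2 i))
      = fun p => ((b p.1 * ∏ i, a (p.2 i) : ℕ) : ℝ) / 1000 ^ (k + 1) := by
  ext p
  simp only [perMille, Finset.prod_div_distrib, Finset.prod_const, Finset.card_univ,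
    Fintype.card_fin]
  push_cast
  rw [div_mul_div_comm, pow_succ']

theorem perMille_mul {n m : ℕ} (a : Fin n → ℕ) (b : Fin m → ℕ) :
    (fun p : Fin m × Fin n => perMille b p.1 * perMille a p.2)
      = fun p => ((b p.1 * a p.2 : ℕ) : ℝ) / 1000 ^ 2 := by
  ext p
  simp only [perMille]
  push_cast
  rw [div_mul_div_comm, sq]

variable {n m : ℕ} {a : Fin n → ℕ} {b : Fin m → ℕ} {L L' : List (ℕ × ℕ)}

theorem incomparable_of_listExcess_lt (ha : Enumerates L a) (hb : Enumerates L' b) {s s' : ℕ}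
    (hs : listExcess L' s < listExcess L s) (hs' : listExcess L s' < listExcess L' s') :
    Incomparable (perMille a) (perMille b) := by
  intro A B C D _ _ _ _ _ _ _ _ ψ φ hψ hφ
  refine ⟨fun h => ?_, fun h => ?_⟩
  · exact absurd (h.excess_le hψ.hasSchmidt hφ.hasSchmidt hψ.2.2.1 hφ.2.2.1
      (div_nonneg (Nat.cast_nonneg s) (by norm_num : (0 : ℝ) ≤ 1000)))
      (not_le.2 (ha.excess_lt hb (by norm_num) hs))
  · exact absurd (h.excess_le hφ.hasSchmidt hψ.hasSchmidt hφ.2.2.1 hψ.2.2.1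
      (div_nonneg (Nat.cast_nonneg s') (by norm_num : (0 : ℝ) ≤ 1000)))
      (not_le.2 (hb.excess_lt ha (by norm_num) hs'))

theorem selfCatalyses_of_listExcess_le (ha : Enumerates L a) (hb : Enumerates L' b)
    (hpos : ∀ i, 0 < a i) (hm : 0 < m) (hmn : m ≤ n)
    (h : ∀ s ∈ 0 :: (mulEntries L' L).map Prod.fst,
      listExcess (mulEntries L L) s ≤ listExcess (mulEntries L' L) s) :
    SelfCatalyses (perMille a) (perMille b) := by
  intro A B C D _ _ _ _ _ _ _ _ ψ φ hψ hφ
  have : NeZero m := ⟨hm.ne'⟩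
  have : NeZero n := ⟨(hm.trans_le hmn).ne'⟩
  have hα : ∀ i, 0 < perMille a i := fun i =>
    div_pos (Nat.cast_pos.2 (hpos i)) (by norm_num)
  refine accesses_of_excess_le (hψ.hasSchmidt.tensorState hψ.hasSchmidt)
    (hφ.hasSchmidt.tensorState hψ.hasSchmidt) (fun p => mul_pos (hα _) (hα _)) ?_ inferInstance ?_ ?_
  · simpa using Nat.mul_le_mul_right n hmn
  · simp only [Fintype.sum_prod_type, ← Finset.mul_sum, hψ.2.2.1, hφ.2.2.1, mul_one]
  · intro t ht
    rw [perMille_mul, perMille_mul]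
    exact (ha.mul ha).excess_le (hb.mul ha) (by positivity) h ht

/-- No monotonicity in the number of copies is invoked: each `k < N` is excluded by its own violated
threshold `s k`. -/
theorem minimalCopies_of_listExcess (ha : Enumerates L a) (hb : Enumerates L' b)
    (hpos : ∀ i, 0 < a i) (hm : 0 < m) (hmn : m ≤ n) {N : ℕ}
    (h : ∀ s ∈ 0 :: (mulEntries L' (powEntries L N)).map Prod.fst,
      listExcess (mulEntries L (powEntries L N)) s
        ≤ listExcess (mulEntries L' (powEntries L N)) s)
    (s : ℕ → ℕ) (hs : ∀ k < N, listExcess (mulEntries L' (powEntries L k)) (s k)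
      < listExcess (mulEntries L (powEntries L k)) (s k)) :
    MinimalCopies (perMille a) (perMille b) N := by
  intro A B C D _ _ _ _ _ _ _ _ ψ φ hψ hφ
  have : NeZero m := ⟨hm.ne'⟩
  have : NeZero n := ⟨(hm.trans_le hmn).ne'⟩
  have hα : ∀ i, 0 < perMille a i := fun i =>
    div_pos (Nat.cast_pos.2 (hpos i)) (by norm_num)
  have hSψ := fun k => hψ.hasSchmidt.tensorState (hψ.hasSchmidt.copies k)
  have hSφ := fun k => hφ.hasSchmidt.tensorState (hψ.hasSchmidt.copies k)
  have h1ψ := fun k => sum_perMille_mul_prod (k := k) hψ.2.2.1 hψ.2.2.1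
  have h1φ := fun k => sum_perMille_mul_prod (k := k) hψ.2.2.1 hφ.2.2.1
  refine ⟨?_, fun k hk => ?_⟩
  · refine accesses_of_excess_le (hSψ N) (hSφ N)
      (fun p => mul_pos (hα _) (Finset.prod_pos fun _ _ => hα _)) ?_ inferInstance
      ((h1ψ N).trans (h1φ N).symm) ?_
    · simpa using Nat.mul_le_mul_right (n ^ N) hmn
    · intro t ht
      rw [perMille_mul_prod, perMille_mul_prod]
      exact (ha.mul (ha.pow N)).excess_le (hb.mul (ha.pow N)) (by positivity) h ht
  · by_contra hkN
    have hle := Accesses.excess_le (hSψ k) (hSφ k) (h1ψ k) (h1φ k) hk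
      (div_nonneg (Nat.cast_nonneg (s k)) (by positivity : (0 : ℝ) ≤ 1000 ^ (k + 1)))
    rw [perMille_mul_prod, perMille_mul_prod] at hle
    exact absurd hle (not_le.2 ((ha.mul (ha.pow k)).excess_lt (hb.mul (ha.pow k))
      (by positivity) (hs k (not_le.1 hkN))))

end Rows

/-! ### The seven rows -/

theorem enumerates_four (p q r s : ℕ) :
    Enumerates [(p, 1), (q, 1), (r, 1), (s, 1)] ![p, q, r, s] := by
  intro g
  simp [Fin.sum_univ_succ]

theorem enumerates_four_of_eq (p q r : ℕ) : Enumerates [(p, 1), (q, 1), (r, 2)] ![p, q, r, r] := by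
  intro g
  simp [Fin.sum_univ_succ, two_mul]

theorem enumerates_three (p q r : ℕ) : Enumerates [(p, 1), (q, 1), (r, 1)] ![p, q, r] := by
  intro g
  simp [Fin.sum_univ_succ]

theorem perMille_four (p q r s : ℕ) :
    perMille ![p, q, r, s] = ![(p : ℝ) / 1000, q / 1000, r / 1000, s / 1000] := by
  ext i
  fin_cases i <;> rfl

theorem perMille_three (p q r : ℕ) :
    perMille ![p, q, r] = ![(p : ℝ) / 1000, q / 1000, r / 1000] := by
  ext i
  fin_cases i <;> rfl

theorem mainTheorem5 :
    (Incomparable ![0.900, 0.081, 0.010, 0.009] ![0.950, 0.030, 0.020] ∧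
      SelfCatalyses ![0.900, 0.081, 0.010, 0.009] ![0.950, 0.030, 0.020] ∧
      MinimalCopies ![0.900, 0.081, 0.010, 0.009] ![0.950, 0.030, 0.020] 1) ∧
    (Incomparable ![0.900, 0.088, 0.006, 0.006] ![0.950, 0.030, 0.020] ∧
      MinimalCopies ![0.900, 0.088, 0.006, 0.006] ![0.950, 0.030, 0.020] 2) ∧
    (Incomparable ![0.908, 0.080, 0.006, 0.006] ![0.950, 0.030, 0.020] ∧
      MinimalCopies ![0.908, 0.080, 0.006, 0.006] ![0.950, 0.030, 0.020] 3) ∧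
    (Incomparable ![0.918, 0.070, 0.006, 0.006] ![0.950, 0.030, 0.020] ∧
      MinimalCopies ![0.918, 0.070, 0.006, 0.006] ![0.950, 0.030, 0.020] 4) ∧
    (Incomparable ![0.925, 0.063, 0.006, 0.006] ![0.950, 0.030, 0.020] ∧
      MinimalCopies ![0.925, 0.063, 0.006, 0.006] ![0.950, 0.030, 0.020] 5) ∧
    (Incomparable ![0.928, 0.060, 0.006, 0.006] ![0.950, 0.030, 0.020] ∧
      MinimalCopies ![0.928, 0.060, 0.006, 0.006] ![0.950, 0.030, 0.020] 6) ∧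
    (Incomparable ![0.900, 0.081, 0.010, 0.009] ![0.950, 0.030, 0.019, 0.001] ∧
      SelfCatalyses ![0.900, 0.081, 0.010, 0.009] ![0.950, 0.030, 0.019, 0.001] ∧
      MinimalCopies ![0.900, 0.081, 0.010, 0.009] ![0.950, 0.030, 0.019, 0.001] 1) := by
  have h900_81_10_9 : ((![0.900, 0.081, 0.010, 0.009] : Fin 4 → ℝ)) = perMille ![900, 81, 10, 9] := by
    rw [perMille_four]; norm_num
  have h900_88_6_6 : ((![0.900, 0.088, 0.006, 0.006] : Fin 4 → ℝ)) = perMille ![900, 88, 6, 6] := by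
    rw [perMille_four]; norm_num
  have h908_80_6_6 : ((![0.908, 0.080, 0.006, 0.006] : Fin 4 → ℝ)) = perMille ![908, 80, 6, 6] := by
    rw [perMille_four]; norm_num
  have h918_70_6_6 : ((![0.918, 0.070, 0.006, 0.006] : Fin 4 → ℝ)) = perMille ![918, 70, 6, 6] := by
    rw [perMille_four]; norm_num
  have h925_63_6_6 : ((![0.925, 0.063, 0.006, 0.006] : Fin 4 → ℝ)) = perMille ![925, 63, 6, 6] := by
    rw [perMille_four]; norm_num
  have h928_60_6_6 : ((![0.928, 0.060, 0.006, 0.006] : Fin 4 → ℝ)) = perMille ![928, 60, 6, 6] := by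
    rw [perMille_four]; norm_num
  have h950_30_20 : ((![0.950, 0.030, 0.020] : Fin 3 → ℝ)) = perMille ![950, 30, 20] := by
    rw [perMille_three]; norm_num
  have h950_30_19_1 : ((![0.950, 0.030, 0.019, 0.001] : Fin 4 → ℝ)) = perMille ![950, 30, 19, 1] := by
    rw [perMille_four]; norm_num
  rw [h900_81_10_9, h900_88_6_6, h908_80_6_6, h918_70_6_6, h925_63_6_6, h928_60_6_6, h950_30_20, h950_30_19_1]
  -- In every row `s = 30` is the second entry of `β`, where `α` has the larger excess, and `s'` is
  -- the first entry of `α`, where `α` has none but `β` does. For too few copies the violated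
  -- threshold is the second entry of `β` times the `k`-th power of the first entry of `α`, in units
  -- of `1000 ^ (-(k + 1))`.
  exact ⟨⟨incomparable_of_listExcess_lt (enumerates_four 900 81 10 9) (enumerates_three 950 30 20)
      (s := 30) (s' := 900) (by decide +kernel) (by decide +kernel),
    selfCatalyses_of_listExcess_le (enumerates_four 900 81 10 9) (enumerates_three 950 30 20)
      (by decide) (by decide) (by decide) (by decide +kernel),
    minimalCopies_of_listExcess (enumerates_four 900 81 10 9) (enumerates_three 950 30 20)
      (by decide) (by decide) (by decide) (by decide +kernel) (fun k => 30 * 900 ^ k) (by decide +kernel)⟩,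
    ⟨incomparable_of_listExcess_lt (enumerates_four_of_eq 900 88 6) (enumerates_three 950 30 20)
      (s := 30) (s' := 900) (by decide +kernel) (by decide +kernel),
    minimalCopies_of_listExcess (enumerates_four_of_eq 900 88 6) (enumerates_three 950 30 20)
      (by decide) (by decide) (by decide) (by decide +kernel) (fun k => 30 * 900 ^ k) (by decide +kernel)⟩,
    ⟨incomparable_of_listExcess_lt (enumerates_four_of_eq 908 80 6) (enumerates_three 950 30 20)
      (s := 30) (s' := 908) (by decide +kernel) (by decide +kernel),
    minimalCopies_of_listExcess (enumerates_four_of_eq 908 80 6) (enumerates_three 950 30 20)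
      (by decide) (by decide) (by decide) (by decide +kernel) (fun k => 30 * 908 ^ k) (by decide +kernel)⟩,
    ⟨incomparable_of_listExcess_lt (enumerates_four_of_eq 918 70 6) (enumerates_three 950 30 20)
      (s := 30) (s' := 918) (by decide +kernel) (by decide +kernel),
    minimalCopies_of_listExcess (enumerates_four_of_eq 918 70 6) (enumerates_three 950 30 20)
      (by decide) (by decide) (by decide) (by decide +kernel) (fun k => 30 * 918 ^ k) (by decide +kernel)⟩,
    ⟨incomparable_of_listExcess_lt (enumerates_four_of_eq 925 63 6) (enumerates_three 950 30 20)
      (s := 30) (s' := 925) (by decide +kernel) (by decide +kernel),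
    minimalCopies_of_listExcess (enumerates_four_of_eq 925 63 6) (enumerates_three 950 30 20)
      (by decide) (by decide) (by decide) (by decide +kernel) (fun k => 30 * 925 ^ k) (by decide +kernel)⟩,
    ⟨incomparable_of_listExcess_lt (enumerates_four_of_eq 928 60 6) (enumerates_three 950 30 20)
      (s := 30) (s' := 928) (by decide +kernel) (by decide +kernel),
    minimalCopies_of_listExcess (enumerates_four_of_eq 928 60 6) (enumerates_three 950 30 20)
      (by decide) (by decide) (by decide) (by decide +kernel) (fun k => 30 * 928 ^ k) (by decide +kernel)⟩,
    ⟨incomparable_of_listExcess_lt (enumerates_four 900 81 10 9) (enumerates_four 950 30 19 1)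
      (s := 30) (s' := 900) (by decide +kernel) (by decide +kernel),
    selfCatalyses_of_listExcess_le (enumerates_four 900 81 10 9) (enumerates_four 950 30 19 1)
      (by decide) (by decide) (by decide) (by decide +kernel),
    minimalCopies_of_listExcess (enumerates_four 900 81 10 9) (enumerates_four 950 30 19 1)
      (by decide) (by decide) (by decide) (by decide +kernel) (fun k => 30 * 900 ^ k) (by decide +kernel)⟩⟩
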